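/- Let $\mathbb{H}^d$ ($d\ge 2$) be $d$-dimensional hyperbolic space of constant curvature $-1$, fix an origin $\mathbf{o}\in\mathbb{H}^d$, and let $B_R^d$ be the closed hyperbolic ball of radius $R$ centred at $\mathbf{o}$. For $\lambda\in[0,1]$, a $\lambda$-geodesic hyperplane is a complete totally umbilic hypersurface of $\mathbb{H}^d$ of normal curvature $\lambda$ (for a suitable choice of unit normal), and $\mathrm{Hyp}_\lambda$ is the set of all of them. For $s\in\mathbb{R}$ and $u$ in the unit sphere $\mathbb{S}^{d-1}$ of $T_{\mathbf{o}}\mathbb{H}^d$, let $H(s,u)\in\mathrm{Hyp}_\lambda$ be the $\lambda$-geodesic hyperplane which passes through $\exp_{\mathbf{o}}(su)$, is orthogonal there to the geodesic $t\mapsto\exp_{\mathbf{o}}(tu)$, and whose unit normal with normal curvature $\lambda$ at this point is opposite to the velocity of this geodesic (so for $\lambda>0$ the direction of the geodesic points out of the convex side of $H(s,u)$, and $s$ is the signed distance of $H(s,u)$ to $\mathbf{o}$). Let $\Lambda_\lambda$ be the isometry-invariant measure on $\mathrm{Hyp}_\lambda$ given by $$\int_{\mathrm{Hyp}_\lambda}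 f(H)\,\Lambda_\lambda(\mathrm{d}H)=\int_{\mathbb{R}}\int_{\mathbb{S}^{d-1}} f(H(s,u))\,(\cosh s-\lambda\sinh s)^{d-1}\,\mathrm{d}u\,\mathrm{d}s$$ for non-negative measurable $f$, where $\mathrm{d}u$ is the normalized surface measure. For integers $k\ge 2$ let $$I_{\lambda,k}(R)=\int_{\mathrm{Hyp}_\lambda}\bigl(\mathcal{H}^{d-1}(H\cap B_R^d)\bigr)^k\,\Lambda_\lambda(\mathrm{d}H),$$ where $\mathcal{H}^{d-1}$ is the $(d-1)$-dimensional hyperbolic Hausdorff measure. Write $a(R)\sim b(R)$ if $a(R)/b(R)\to1$ as $R\to\infty$. (i) Let $d=2$. There are constants $A_k,B_k\in(0,\infty)$, $k\ge2$, depending only on $k$, and constants $R_{k,\lambda}$ depending only on $k$ and $\lambda$, such that for all $\lambda\in[0,1)$, $k\ge 2$ and $R>R_{k,\lambda}$ $$A_k(1-\lambda)^{-(k/2-1)}e^R\le I_{\lambda,k}(R)\le B_k(1-\lambda)^{-k/2}e^R .$$ (ii) Let $d=3$. There are constants $A_k\in(0,\infty)$, $k\ge2$, depending only on $k$, such that for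 all $\lambda\in[0,1)$, as $R\to\infty$, $$I_{\lambda,k}(R)\sim A_k(1-\lambda^2)^{1-k/2}e^{kR}\ \text{ for } k>2,\qquad I_{\lambda,2}(R)\sim A_2\,R\,e^{2R}.$$ (iii) There are constants $A_{k,d}\in(0,\infty)$, $k\ge 2$, $d\ge4$, depending only on $k$ and $d$, such that for all $d\ge4$, $k\ge2$ and $\lambda\in[0,1)$, as $R\to\infty$, $$I_{\lambda,k}(R)\sim A_{k,d}\,(1-\lambda^2)^{(d-1-k)/2}\,e^{k(d-2)R}.$$ (iv) Let $\lambda=1$. There are constants $A_{k,d}\in(0,\infty)$, $k\ge2$, $d\ge2$, depending only on $k$ and $d$, such that for all $d\ge2$, as $R\to\infty$, $$I_{1,k}(R)\sim A_{k,d}\,e^{(k-1)(d-1)R}\ \text{ for } k>2,\qquad I_{1,2}(R)\sim A_{2,d}\,R\,e^{(d-1)R}.$$ -/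

import Mathlib

open MeasureTheory Filter Topology Asymptotics
open scoped ENNReal ContDiff

noncomputable section

namespace LambdaHyp

/-! ### Hyperbolic space: the hyperboloid model -/

/-- Minkowski space `ℝ^{1,d}`: a time coordinate and `d` spatial coordinates. -/
abbrev Mink (d : ℕ) : Type := ℝ × EuclideanSpace ℝ (Fin d)

/-- The Lorentzian bilinear form `⟨x, y⟩ = -x₀ y₀ + x₁ y₁ + ⋯ + x_d y_d`. -/
def lor {d : ℕ} (x y : Mink d) : ℝ := inner ℝ x.2 y.2 - x.1 * y.1

/-- `d`-dimensional hyperbolic space of curvature `-1`, as the upper sheet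
`{x : ⟨x, x⟩ = -1, x₀ > 0}` of the hyperboloid. -/
def HypSpace (d : ℕ) : Type := {x : Mink d // lor x x = -1 ∧ 0 < x.1}

namespace HypSpace

/-- The inclusion of hyperbolic space in Minkowski space. -/
def emb {d : ℕ} (x : HypSpace d) : Mink d := x.1

end HypSpace

open HypSpace

section Lorentz

variable {d : ℕ}

lemma lor_comm (x y : Mink d) : lor x y = lor y x := by
  simp only [lor, real_inner_comm x.2 y.2, mul_comm x.1 y.1]

lemma lor_add_left (x y z : Mink d) : lor (x + y) z = lor x z + lor y z := by
  simp only [lor, Prod.snd_add, Prod.fst_add, inner_add_left]; ring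

lemma lor_add_right (x y z : Mink d) : lor x (y + z) = lor x y + lor x z := by
  simp only [lor, Prod.snd_add, Prod.fst_add, inner_add_right]; ring

lemma lor_smul_left (c : ℝ) (x y : Mink d) : lor (c • x) y = c * lor x y := by
  simp only [lor, Prod.smul_snd, Prod.smul_fst, real_inner_smul_left, smul_eq_mul]; ring

lemma lor_smul_right (c : ℝ) (x y : Mink d) : lor x (c • y) = c * lor x y := by
  simp only [lor, Prod.smul_snd, Prod.smul_fst, real_inner_smul_right, smul_eq_mul]; ring

lemma lor_neg_right (x y : Mink d) : lor x (-y) = -lor x y := by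
  simp only [lor, Prod.snd_neg, Prod.fst_neg, inner_neg_right]; ring

lemma lor_self (x : Mink d) : lor x x = ‖x.2‖ ^ 2 - x.1 ^ 2 := by
  simp only [lor, real_inner_self_eq_norm_sq]; ring

lemma hasDerivAt_lor {f g : ℝ → Mink d} {f' g' : Mink d} {t : ℝ}
    (hf : HasDerivAt f f' t) (hg : HasDerivAt g g' t) :
    HasDerivAt (fun t => lor (f t) (g t)) (lor f' (g t) + lor (f t) g') t := by
  have h1 : HasDerivAt (fun t => (f t).1) f'.1 t := hf.fst
  have h2 : HasDerivAt (fun t => (f t).2) f'.2 t := hf.snd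
  have h3 : HasDerivAt (fun t => (g t).1) g'.1 t := hg.fst
  have h4 : HasDerivAt (fun t => (g t).2) g'.2 t := hg.snd
  refine ((h2.inner ℝ h4).sub (h1.mul h3)).congr_deriv ?_
  simp only [lor]; ring

lemma lor_emb_self (x : HypSpace d) : lor x.emb x.emb = -1 := x.2.1

lemma fst_emb_pos (x : HypSpace d) : 0 < x.emb.1 := x.2.2

/-- Vectors orthogonal to a point of the hyperboloid are spacelike. -/
lemma lor_self_nonneg_of_orth (y : HypSpace d) {v : Mink d} (hv : lor y.emb v = 0) :
    0 ≤ lor v v := by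
  have h0 := lor_emb_self y
  have hp := fst_emb_pos y
  rw [lor_self] at h0 ⊢
  simp only [lor] at hv
  have hcs := abs_real_inner_le_norm y.emb.2 v.2
  have h1 : inner ℝ y.emb.2 v.2 = y.emb.1 * v.1 := by linarith
  have h2 : (y.emb.1 * v.1) ^ 2 ≤ (‖y.emb.2‖ * ‖v.2‖) ^ 2 := by
    rw [← h1]; exact sq_le_sq' (by linarith [neg_abs_le (inner ℝ y.emb.2 v.2)])
      ((le_abs_self _).trans hcs)
  have h3 : y.emb.1 ^ 2 * v.1 ^ 2 ≤ y.emb.1 ^ 2 * ‖v.2‖ ^ 2 := by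
    have : ‖y.emb.2‖ ^ 2 = y.emb.1 ^ 2 - 1 := by linarith
    have h4 : y.emb.1 ^ 2 * v.1 ^ 2 ≤ (y.emb.1 ^ 2 - 1) * ‖v.2‖ ^ 2 := by
      rw [← this]; nlinarith [h2]
    nlinarith [sq_nonneg ‖v.2‖]
  have := le_of_mul_le_mul_left h3 (by positivity)
  linarith

lemma lor_sq_le_of_orth (y : HypSpace d) {v w : Mink d} (hv : lor y.emb v = 0)
    (hw : lor y.emb w = 0) : lor v w ^ 2 ≤ lor v v * lor w w := by
  have key : ∀ t : ℝ, 0 ≤ lor w w * (t * t) + (2 * lor v w) * t + lor v v := by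
    intro t
    have h := lor_self_nonneg_of_orth y (v := v + t • w)
      (by rw [lor_add_right, lor_smul_right, hv, hw]; ring)
    simp only [lor_add_left, lor_add_right, lor_smul_left, lor_smul_right, lor_comm w v] at h
    linarith
  have := discrim_le_zero key
  unfold discrim at this
  nlinarith

lemma one_le_neg_lor (x y : HypSpace d) : 1 ≤ -lor x.emb y.emb := by
  have hx := lor_emb_self x
  have hy := lor_emb_self y
  have px := fst_emb_pos x
  have py := fst_emb_pos y
  rw [lor_self] at hx hy
  simp only [lor]
  have hcs := real_inner_le_norm x.emb.2 y.emb.2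
  have nx := norm_nonneg x.emb.2
  have ny := norm_nonneg y.emb.2
  have h : 1 + ‖x.emb.2‖ * ‖y.emb.2‖ ≤ x.emb.1 * y.emb.1 := by
    refine le_of_sq_le_sq ?_ (by positivity)
    have : (x.emb.1 * y.emb.1) ^ 2 = (1 + ‖x.emb.2‖ ^ 2) * (1 + ‖y.emb.2‖ ^ 2) := by
      rw [mul_pow]; congr 1 <;> linarith
    rw [this]
    nlinarith [sq_nonneg (‖x.emb.2‖ - ‖y.emb.2‖)]
  linarith

end Lorentz

namespace HypSpace

variable {d : ℕ}

lemma emb_injective : Function.Injective (emb : HypSpace d → Mink d) := Subtype.val_injective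

lemma eq_of_neg_lor_eq_one {x y : HypSpace d} (h : -lor x.emb y.emb = 1) : x = y := by
  have h1 : lor (x.emb - y.emb) (x.emb - y.emb) = 0 := by
    have : x.emb - y.emb = x.emb + (-1 : ℝ) • y.emb := by simp [sub_eq_add_neg]
    rw [this]
    simp only [lor_add_left, lor_add_right, lor_smul_left, lor_smul_right, lor_comm y.emb x.emb,
      lor_emb_self]
    linarith
  have hx := lor_emb_self x
  have hy := lor_emb_self y
  rw [lor_self] at hx hy
  have hcs := real_inner_le_norm x.emb.2 y.emb.2
  have hl : x.emb.1 * y.emb.1 = 1 + inner ℝ x.emb.2 y.emb.2 := by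
    simp only [lor] at h; linarith
  have hn : ‖x.emb.2 - y.emb.2‖ ^ 2 =
      ‖x.emb.2‖ ^ 2 - 2 * inner ℝ x.emb.2 y.emb.2 + ‖y.emb.2‖ ^ 2 := norm_sub_sq_real _ _
  have h2 : (x.emb.1 * y.emb.1) ^ 2 = (1 + ‖x.emb.2‖ ^ 2) * (1 + ‖y.emb.2‖ ^ 2) := by
    rw [mul_pow]; congr 1 <;> linarith
  have h3 : (inner ℝ x.emb.2 y.emb.2) ^ 2 ≤ (‖x.emb.2‖ * ‖y.emb.2‖) ^ 2 := by
    have := abs_real_inner_le_norm x.emb.2 y.emb.2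
    exact sq_le_sq' (by linarith [neg_abs_le (inner ℝ x.emb.2 y.emb.2)]) hcs
  have h4 : ‖x.emb.2 - y.emb.2‖ ^ 2 ≤ 0 := by
    rw [hn]; rw [hl] at h2; nlinarith
  have h5 : ‖x.emb.2 - y.emb.2‖ = 0 := by
    have := norm_nonneg (x.emb.2 - y.emb.2); nlinarith
  have h6 : x.emb.2 = y.emb.2 := sub_eq_zero.1 (norm_eq_zero.1 h5)
  apply emb_injective
  refine Prod.ext ?_ h6
  have px := fst_emb_pos x
  have py := fst_emb_pos y
  rw [h6] at hx
  have : (x.emb.1 - y.emb.1) * (x.emb.1 + y.emb.1) = 0 := by nlinarith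
  rcases mul_eq_zero.1 this with h | h <;> linarith

/-- The hyperbolic distance: `cosh dist(x, y) = -⟨x, y⟩`. -/
instance : Dist (HypSpace d) := ⟨fun x y => Real.arcosh (-lor x.emb y.emb)⟩

lemma dist_def (x y : HypSpace d) : dist x y = Real.arcosh (-lor x.emb y.emb) := rfl

lemma cosh_dist (x y : HypSpace d) : Real.cosh (dist x y) = -lor x.emb y.emb :=
  Real.cosh_arcosh (one_le_neg_lor x y)

lemma dist_triangle' (x y z : HypSpace d) : dist x z ≤ dist x y + dist y z := by
  have ha : 0 ≤ dist x y := Real.arcosh_nonneg (one_le_neg_lor x y)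
  have hb : 0 ≤ dist y z := Real.arcosh_nonneg (one_le_neg_lor y z)
  have hc : 0 ≤ dist x z := Real.arcosh_nonneg (one_le_neg_lor x z)
  rw [← abs_of_nonneg hc, ← abs_of_nonneg (add_nonneg ha hb), ← Real.cosh_le_cosh,
    Real.cosh_add, cosh_dist x z]
  set a := Real.cosh (dist x y) with hadef
  set b := Real.cosh (dist y z) with hbdef
  have hA : lor x.emb y.emb = -a := by rw [hadef, cosh_dist]; ring
  have hB : lor y.emb z.emb = -b := by rw [hbdef, cosh_dist]; ring
  have hA' : lor y.emb x.emb = -a := by rw [lor_comm, hA]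
  have hB' : lor z.emb y.emb = -b := by rw [lor_comm, hB]
  have h1 : lor y.emb (x.emb + (-a) • y.emb) = 0 := by
    rw [lor_add_right, lor_smul_right, lor_emb_self, hA']; ring
  have h2 : lor y.emb (z.emb + (-b) • y.emb) = 0 := by
    rw [lor_add_right, lor_smul_right, lor_emb_self, hB]; ring
  have h := lor_sq_le_of_orth y h1 h2
  simp only [lor_add_left, lor_add_right, lor_smul_left, lor_smul_right, lor_emb_self, hA, hA',
    hB, hB'] at h
  have sa : Real.sinh (dist x y) ^ 2 = a ^ 2 - 1 := by rw [Real.sinh_sq]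
  have sb : Real.sinh (dist y z) ^ 2 = b ^ 2 - 1 := by rw [Real.sinh_sq]
  have pa : 0 ≤ Real.sinh (dist x y) := Real.sinh_nonneg_iff.2 ha
  have pb : 0 ≤ Real.sinh (dist y z) := Real.sinh_nonneg_iff.2 hb
  have h3 : (-lor x.emb z.emb - a * b) ^ 2 ≤
      (Real.sinh (dist x y) * Real.sinh (dist y z)) ^ 2 := by
    rw [mul_pow, sa, sb]; nlinarith
  have := abs_le_of_sq_le_sq' h3 (by positivity)
  linarith [this.2]

instance : MetricSpace (HypSpace d) where
  dist_self x := by rw [dist_def, lor_emb_self]; simp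
  dist_comm x y := by rw [dist_def, dist_def, lor_comm]
  dist_triangle := dist_triangle'
  eq_of_dist_eq_zero {x y} h := by
    rw [dist_def, Real.arcosh_eq_zero_iff (one_le_neg_lor x y)] at h
    exact eq_of_neg_lor_eq_one h

instance : MeasurableSpace (HypSpace d) := borel _

instance : BorelSpace (HypSpace d) := ⟨rfl⟩

/-- The origin `𝐨 = (1, 0, …, 0)`. Its tangent space is `{0} × ℝ^d`. -/
def origin : HypSpace d := ⟨(1, 0), by simp [lor], by simp⟩

/-- The point `exp_𝐨(s u)` at time `s` on the unit speed geodesic starting from the origin in the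
direction of the unit tangent vector `u`. -/
def geo (s : ℝ) (u : Metric.sphere (0 : EuclideanSpace ℝ (Fin d)) 1) : HypSpace d :=
  ⟨(Real.cosh s, Real.sinh s • (u : EuclideanSpace ℝ (Fin d))), by
    have hu : ‖(u : EuclideanSpace ℝ (Fin d))‖ = 1 := by simp
    rw [lor_self, norm_smul, hu, Real.norm_eq_abs, mul_one, sq_abs, Real.sinh_sq]; ring,
    Real.cosh_pos s⟩

/-- The velocity at time `s` of the geodesic `s ↦ geo s u`. -/
def geoVel (s : ℝ) (u : Metric.sphere (0 : EuclideanSpace ℝ (Fin d)) 1) : Mink d :=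
  (Real.sinh s, Real.cosh s • (u : EuclideanSpace ℝ (Fin d)))

lemma continuous_fst_emb : Continuous fun x : HypSpace d => x.emb.1 := by
  have : (fun x : HypSpace d => x.emb.1) = fun x => Real.cosh (dist x origin) := by
    funext x; rw [cosh_dist]; simp [lor, origin, emb]
  rw [this]; fun_prop

lemma continuous_snd_emb : Continuous fun x : HypSpace d => x.emb.2 := by
  refine continuous_iff_continuousAt.2 fun y => tendsto_iff_norm_sub_tendsto_zero.2 ?_
  have h : ∀ x : HypSpace d, ‖x.emb.2 - y.emb.2‖ =
      √(2 * (Real.cosh (dist x y) - 1) + (x.emb.1 - y.emb.1) ^ 2) := by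
    intro x
    have hx := lor_emb_self x
    have hy := lor_emb_self y
    rw [lor_self] at hx hy
    have hn : ‖x.emb.2 - y.emb.2‖ ^ 2 =
      ‖x.emb.2‖ ^ 2 - 2 * inner ℝ x.emb.2 y.emb.2 + ‖y.emb.2‖ ^ 2 := norm_sub_sq_real _ _
    rw [← Real.sqrt_sq (norm_nonneg (x.emb.2 - y.emb.2)), hn, cosh_dist]
    congr 1
    simp only [lor]; linarith
  simp only [h]
  have hc : Continuous fun x : HypSpace d =>
      √(2 * (Real.cosh (dist x y) - 1) + (x.emb.1 - y.emb.1) ^ 2) := by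
    have := continuous_fst_emb (d := d)
    fun_prop
  have := hc.tendsto y
  simpa using this

lemma continuous_emb : Continuous (emb : HypSpace d → Mink d) :=
  continuous_fst_emb.prodMk continuous_snd_emb

lemma continuous_of_emb {X : Type*} [TopologicalSpace X] {f : X → HypSpace d}
    (h : Continuous fun x => (f x).emb) : Continuous f := by
  refine continuous_iff_continuousAt.2 fun y => tendsto_iff_dist_tendsto_zero.2 ?_
  have h1 : Continuous fun x => -lor (f x).emb (f y).emb := by
    unfold lor; fun_prop
  have h2 : Continuous fun x => dist (f x) (f y) :=
    Real.continuousOn_arcosh.comp_continuous h1 fun x => one_le_neg_lor _ _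
  simpa using h2.tendsto y

end HypSpace

/-! ### Totally umbilic hypersurfaces -/

section Hypersurfaces

variable {d : ℕ}

/-- `H` is a smooth (embedded) hypersurface of hyperbolic space: near each of its points it is the
zero set in `ℍ^d` of a smooth function whose differential does not vanish on the tangent space
`T_p ℍ^d = {ξ : ⟨p, ξ⟩ = 0}`. -/
def IsSmoothHypersurface (H : Set (HypSpace d)) : Prop :=
  ∀ p ∈ H, ∃ U : Set (Mink d), IsOpen U ∧ p.emb ∈ U ∧ ∃ f : Mink d → ℝ, ContDiffOn ℝ ∞ f U ∧
    (∃ ξ : Mink d, lor p.emb ξ = 0 ∧ fderiv ℝ f p.emb ξ ≠ 0) ∧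
    ∀ x : HypSpace d, x.emb ∈ U → (x ∈ H ↔ f x.emb = 0)

/-- `γ` is (near time `0`) a smooth curve in `H` with `γ(0) = p`. -/
def IsCurveThrough (H : Set (HypSpace d)) (p : HypSpace d) (γ : ℝ → Mink d) : Prop :=
  ContDiffAt ℝ ∞ γ 0 ∧ (∀ᶠ t in 𝓝 0, γ t ∈ emb '' H) ∧ γ 0 = p.emb

/-- `n` is a unit normal vector of `H` at `p`: a unit vector in `T_p ℍ^d` which is orthogonal to
all tangent vectors of `H` at `p`. -/
def IsUnitNormal (H : Set (HypSpace d)) (p : HypSpace d) (n : Mink d) : Prop :=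
  lor p.emb n = 0 ∧ lor n n = 1 ∧
    ∀ γ : ℝ → Mink d, IsCurveThrough H p γ → lor (deriv γ 0) n = 0

/-- With respect to the unit normal `n`, the point `p` of `H` is umbilic with normal curvature
`lam`: the second fundamental form `B(X, X) = g(∇_X X, n)` equals `lam * g(X, X)` for all `X` in
`T_p H`. For a curve `γ` in `H` with velocity `X`, the covariant derivative `∇_X X` of `ℍ^d` is the
component of `γ''` tangent to the hyperboloid, and as `n` is itself tangent to the hyperboloid
`B(X, X) = ⟨γ'', n⟩`. -/
def IsUmbilicAt (lam : ℝ) (H : Set (HypSpace d)) (p : HypSpace d) (n : Mink d) : Prop :=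
  IsUnitNormal H p n ∧ ∀ γ : ℝ → Mink d, IsCurveThrough H p γ →
    lor (deriv (deriv γ) 0) n = lam * lor (deriv γ 0) (deriv γ 0)

/-- `lam`-geodesic hyperplanes: complete (connected, embedded) totally umbilic hypersurfaces of
normal curvature `lam`, for a suitable choice of the unit normal at each point. As `ℍ^d` is
complete, completeness of `H` amounts to `H` being closed. -/
structure IsLambdaGeodesic (lam : ℝ) (H : Set (HypSpace d)) : Prop where
  connected : IsConnected H
  closed : IsClosed H
  smooth : IsSmoothHypersurface H
  umbilic : ∀ p ∈ H, ∃ n : Mink d, IsUmbilicAt lam H p n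

/-- The Minkowski vector `γ'(s) - lam γ(s)`, where `γ` is the geodesic `s ↦ geo s u`. -/
def polar (lam s : ℝ) (u : Metric.sphere (0 : EuclideanSpace ℝ (Fin d)) 1) : Mink d :=
  geoVel s u + (-lam) • (geo s u).emb

/-- The `lam`-geodesic hyperplane `H(s, u)`: it meets the geodesic from the origin `𝐨` in direction
`u` orthogonally at the point `geo s u` of signed distance `s` from `𝐨`, and `u` points out of its
convex side. It is the section of the hyperboloid by the affine hyperplane through `geo s u`
orthogonal to `polar lam s u`; see `isLambdaGeodesic_hyperplane`, `geo_mem_hyperplane`,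
`isUmbilicAt_geo`, `infDist_hyperplane` for its characteristic properties. -/
def hyperplane (lam s : ℝ) (u : Metric.sphere (0 : EuclideanSpace ℝ (Fin d)) 1) :
    Set (HypSpace d) :=
  {x | lor x.emb (polar lam s u) = lam}

variable {lam s : ℝ} {u : Metric.sphere (0 : EuclideanSpace ℝ (Fin d)) 1}

lemma inner_sphere_self :
    inner ℝ (u : EuclideanSpace ℝ (Fin d)) (u : EuclideanSpace ℝ (Fin d)) = (1 : ℝ) := by
  rw [real_inner_self_eq_norm_sq]; simp

lemma polar_fst : (polar lam s u).1 = Real.sinh s - lam * Real.cosh s := by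
  simp [polar, geoVel, geo, emb]; ring

lemma polar_snd : (polar lam s u).2 =
    (Real.cosh s - lam * Real.sinh s) • (u : EuclideanSpace ℝ (Fin d)) := by
  have : (polar lam s u).2 = Real.cosh s • (u : EuclideanSpace ℝ (Fin d)) +
      (-lam) • (Real.sinh s • (u : EuclideanSpace ℝ (Fin d))) := rfl
  rw [this]; module

lemma lor_geoVel_self : lor (geoVel s u) (geoVel s u) = 1 := by
  simp only [lor, geoVel, real_inner_smul_left, real_inner_smul_right, inner_sphere_self]
  nlinarith [Real.cosh_sq s]

lemma lor_geo_geoVel : lor (geo s u).emb (geoVel s u) = 0 := by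
  simp only [lor, geoVel, geo, emb, real_inner_smul_left, real_inner_smul_right,
    inner_sphere_self]
  ring

lemma lor_polar_self : lor (polar lam s u) (polar lam s u) = 1 - lam ^ 2 := by
  simp only [polar, lor_add_left, lor_add_right, lor_smul_left, lor_smul_right, lor_emb_self,
    lor_geoVel_self, lor_comm (geoVel s u) _, lor_geo_geoVel]
  ring

/-- `H(s, u)` passes through the point `exp_𝐨(s u)`. -/
lemma geo_mem_hyperplane : geo s u ∈ hyperplane lam s u := by
  simp only [hyperplane, Set.mem_ofPred_eq, polar, lor_add_right, lor_smul_right, lor_emb_self,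
    lor_geo_geoVel]
  ring

lemma isUmbilicAt_of_mem {p : HypSpace d} (hp : p ∈ hyperplane lam s u) :
    IsUmbilicAt lam (hyperplane lam s u) p (-(polar lam s u + lam • p.emb)) := by
  have hpw : lor p.emb (polar lam s u) = lam := hp
  have hwp : lor (polar lam s u) p.emb = lam := by rw [lor_comm]; exact hp
  have main : ∀ γ : ℝ → Mink d, IsCurveThrough (hyperplane lam s u) p γ →
      lor (deriv γ 0) (polar lam s u) = 0 ∧ lor (deriv γ 0) p.emb = 0 ∧
      lor (deriv (deriv γ) 0) (polar lam s u) = 0 ∧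
      lor (deriv (deriv γ) 0) p.emb = -lor (deriv γ 0) (deriv γ 0) := by
    rintro γ ⟨hγ, hH, h0⟩
    have hd : ∀ᶠ t in 𝓝 (0 : ℝ), HasDerivAt γ (deriv γ t) t := by
      filter_upwards [(hγ.of_le (m := 1) (by exact_mod_cast le_top)).eventually (by simp)]
        with t ht
      exact (ht.differentiableAt (by simp)).hasDerivAt
    have hdd : HasDerivAt (deriv γ) (deriv (deriv γ) 0) 0 := by
      have h2 : ContDiffAt ℝ 1 (deriv γ) 0 := by
        have := hγ.fderiv_right (m := 1) (by
          norm_num; exact WithTop.coe_le_coe.2 (le_top : (2 : ℕ∞) ≤ ⊤))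
        simpa only [fderiv_eq_smul_deriv, one_smul] using
          this.clm_apply (contDiffAt_const (c := (1 : ℝ)))
      exact (h2.differentiableAt (by simp)).hasDerivAt
    have e1 : (fun t => lor (γ t) (polar lam s u)) =ᶠ[𝓝 0] fun _ => lam := by
      filter_upwards [hH] with t ⟨x, hx, hxt⟩
      rw [← hxt]; exact hx
    have e2 : (fun t => lor (γ t) (γ t)) =ᶠ[𝓝 0] fun _ => (-1 : ℝ) := by
      filter_upwards [hH] with t ⟨x, hx, hxt⟩
      rw [← hxt]; exact lor_emb_self x
    have f1 : (fun t => lor (deriv γ t) (polar lam s u)) =ᶠ[𝓝 0] fun _ => (0 : ℝ) := by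
      filter_upwards [e1.eventuallyEq_nhds, hd] with t ht hdt
      have a := hasDerivAt_lor hdt (hasDerivAt_const t (polar lam s u))
      have b := (hasDerivAt_const t lam).congr_of_eventuallyEq ht
      have := a.unique b
      simpa [lor] using this
    have f2 : (fun t => lor (deriv γ t) (γ t)) =ᶠ[𝓝 0] fun _ => (0 : ℝ) := by
      filter_upwards [e2.eventuallyEq_nhds, hd] with t ht hdt
      have a := hasDerivAt_lor hdt hdt
      have b := (hasDerivAt_const t (-1 : ℝ)).congr_of_eventuallyEq ht
      have := a.unique b
      rw [lor_comm (γ t)] at this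
      linarith
    refine ⟨f1.self_of_nhds, h0 ▸ f2.self_of_nhds, ?_, ?_⟩
    · have a := hasDerivAt_lor hdd (hasDerivAt_const 0 (polar lam s u))
      have b := (hasDerivAt_const (0 : ℝ) (0 : ℝ)).congr_of_eventuallyEq f1
      have := a.unique b
      simpa [lor] using this
    · have a := hasDerivAt_lor hdd hd.self_of_nhds
      have b := (hasDerivAt_const (0 : ℝ) (0 : ℝ)).congr_of_eventuallyEq f2
      have := a.unique b
      rw [h0] at this
      linarith
  refine ⟨⟨?_, ?_, fun γ hγ => ?_⟩, fun γ hγ => ?_⟩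
  · rw [lor_neg_right, lor_add_right, lor_smul_right, lor_emb_self, hpw]; ring
  · rw [lor_neg_right, lor_comm, lor_neg_right]
    simp only [lor_add_left, lor_add_right, lor_smul_left, lor_smul_right, lor_emb_self, hpw, hwp,
      lor_polar_self]
    ring
  · obtain ⟨h1, h2, -, -⟩ := main γ hγ
    rw [lor_neg_right, lor_add_right, lor_smul_right, h1, h2]; ring
  · obtain ⟨-, -, h3, h4⟩ := main γ hγ
    rw [lor_neg_right, lor_add_right, lor_smul_right, h3, h4]; ring

/-- At `exp_𝐨(s u)` the unit normal of `H(s, u)` for which the normal curvature is `lam` (for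
`lam > 0`, the one pointing to the convex side) is opposite to the velocity of the geodesic
starting from `𝐨` in direction `u`. -/
lemma isUmbilicAt_geo :
    IsUmbilicAt lam (hyperplane lam s u) (geo s u) (-geoVel s u) := by
  have h := isUmbilicAt_of_mem (geo_mem_hyperplane (lam := lam) (s := s) (u := u))
  rwa [show -(polar lam s u + lam • (geo s u).emb) = -geoVel s u by simp [polar]] at h

lemma isClosed_hyperplane : IsClosed (hyperplane lam s u) := by
  have h : Continuous fun x : HypSpace d => lor x.emb (polar lam s u) := by
    have := continuous_emb (d := d)
    unfold lor; fun_prop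
  exact isClosed_eq h continuous_const

lemma isSmoothHypersurface_hyperplane : IsSmoothHypersurface (hyperplane lam s u) := by
  intro p hp
  have hpw : lor p.emb (polar lam s u) = lam := hp
  have hwp : lor (polar lam s u) p.emb = lam := by rw [lor_comm]; exact hp
  set w := polar lam s u with hw
  let L : Mink d →L[ℝ] ℝ :=
    (innerSL ℝ w.2).comp (ContinuousLinearMap.snd ℝ ℝ _) - w.1 • ContinuousLinearMap.fst ℝ ℝ _
  have hL : ∀ x, L x = lor x w := by
    intro x; simp [L, lor, real_inner_comm, mul_comm]
  refine ⟨Set.univ, isOpen_univ, trivial, fun x => L x - lam, ?_, ⟨w + lam • p.emb, ?_, ?_⟩, ?_⟩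
  · exact (L.contDiff.sub contDiff_const).contDiffOn
  · rw [lor_add_right, lor_smul_right, lor_emb_self, hpw]; ring
  · rw [fderiv_sub_const, L.fderiv, hL, lor_add_left, lor_smul_left, hpw, lor_polar_self]
    ring_nf; norm_num
  · intro x _
    simp only [hL, sub_eq_zero]; rfl

lemma polar_snd_coeff_pos (h0 : 0 ≤ lam) (h1 : lam ≤ 1) :
    0 < Real.cosh s - lam * Real.sinh s := by
  have h := Real.sinh_lt_cosh s
  have h' := Real.cosh_pos s
  rcases le_total 0 (Real.sinh s) with hs | hs
  · nlinarith
  · nlinarith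

lemma root_aux {C D A l : ℝ} (hs : (D + l * A) ^ 2 = l ^ 2 * A ^ 2 + (1 - l ^ 2) * C)
    (hD : D ≠ 0) : (1 - l ^ 2) * (C / D) ^ 2 - 2 * l * A * (C / D) - C = 0 := by
  have h : (1 - l ^ 2) * (C / D) ^ 2 - 2 * l * A * (C / D) - C =
      C / D ^ 2 * ((1 - l ^ 2) * C - 2 * l * A * D - D ^ 2) := by
    field_simp
  rw [h]
  have : (1 - l ^ 2) * C - 2 * l * A * D - D ^ 2 = 0 := by linear_combination (-1 : ℝ) * hs
  rw [this, mul_zero]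

lemma norm_aux {a n A B l : ℝ} (hB : 0 < B) (hAB : B ^ 2 - A ^ 2 = 1 - l ^ 2)
    (h : (1 - l ^ 2) * a ^ 2 - 2 * l * A * a - (l ^ 2 + B ^ 2 * (1 + n)) = 0) :
    ((l + a * A) / B) ^ 2 + n - a ^ 2 = -1 := by
  have h2 : ((l + a * A) / B) ^ 2 = (l + a * A) ^ 2 / B ^ 2 := div_pow _ _ _
  have h3 : (l + a * A) ^ 2 = B ^ 2 * (a ^ 2 - 1 - n) := by
    linear_combination (-1 : ℝ) * h - a ^ 2 * hAB
  rw [h2, h3, mul_div_cancel_left₀ _ (by positivity)]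
  ring

lemma sqrt_aux {C A l x : ℝ} (h : 0 ≤ (1 - l ^ 2) * x - l * A)
    (hq : (1 - l ^ 2) * x ^ 2 - 2 * l * A * x - C = 0) :
    √(l ^ 2 * A ^ 2 + (1 - l ^ 2) * C) = (1 - l ^ 2) * x - l * A := by
  rw [← Real.sqrt_sq h]
  congr 1
  linear_combination (-(1 - l ^ 2)) * hq

lemma isConnected_hyperplane (h0 : 0 ≤ lam) (h1 : lam ≤ 1) :
    IsConnected (hyperplane lam s u) := by
  obtain ⟨A, hA⟩ : ∃ A, A = Real.sinh s - lam * Real.cosh s := ⟨_, rfl⟩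
  obtain ⟨B, hB⟩ : ∃ B, B = Real.cosh s - lam * Real.sinh s := ⟨_, rfl⟩
  have hBpos : 0 < B := hB ▸ polar_snd_coeff_pos h0 h1
  have hAB : B ^ 2 - A ^ 2 = 1 - lam ^ 2 := by
    rw [hA, hB]; nlinarith [Real.cosh_sq s]
  have hm : 0 ≤ 1 - lam ^ 2 := by nlinarith
  have hlor : ∀ x : Mink d, lor x (polar lam s u) =
      B * inner ℝ (u : EuclideanSpace ℝ (Fin d)) x.2 - A * x.1 := by
    intro x
    simp only [lor, polar_fst, polar_snd, real_inner_smul_right, ← hA, ← hB,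
      real_inner_comm x.2]
    ring
  -- orthogonal projection to `u^⊥`
  let P : EuclideanSpace ℝ (Fin d) → EuclideanSpace ℝ (Fin d) := fun z =>
    z - (inner ℝ (u : EuclideanSpace ℝ (Fin d)) z : ℝ) • (u : EuclideanSpace ℝ (Fin d))
  have hPu : ∀ z, inner ℝ (u : EuclideanSpace ℝ (Fin d)) (P z) = (0 : ℝ) := by
    intro z; simp only [P, inner_sub_right, real_inner_smul_right, inner_sphere_self]; ring
  let C : EuclideanSpace ℝ (Fin d) → ℝ := fun z => lam ^ 2 + B ^ 2 * (1 + ‖P z‖ ^ 2)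
  have hC : ∀ z, 0 < C z := fun z => by positivity
  let D : EuclideanSpace ℝ (Fin d) → ℝ := fun z =>
    √(lam ^ 2 * A ^ 2 + (1 - lam ^ 2) * C z) - lam * A
  have hD0 : ∀ z, 0 ≤ lam ^ 2 * A ^ 2 + (1 - lam ^ 2) * C z := fun z => by
    have := mul_nonneg hm (hC z).le
    positivity
  have hD : ∀ z, 0 < D z := by
    intro z
    have hz := hC z
    rcases h1.lt_or_eq with hl | hl
    · have : 0 < (1 - lam ^ 2) * C z := mul_pos (by nlinarith) hz
      have h2 : |lam * A| < √(lam ^ 2 * A ^ 2 + (1 - lam ^ 2) * C z) := by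
        rw [← Real.sqrt_sq_eq_abs]
        exact Real.sqrt_lt_sqrt (sq_nonneg _) (by nlinarith)
      have := le_abs_self (lam * A)
      simp only [D]; linarith
    · have h2 : A < 0 := by rw [hA, hl]; linarith [Real.sinh_lt_cosh s]
      have h3 := Real.sqrt_nonneg (lam ^ 2 * A ^ 2 + (1 - lam ^ 2) * C z)
      have h4 : lam * A < 0 := by rw [hl]; linarith
      simp only [D]; linarith
  let a : EuclideanSpace ℝ (Fin d) → ℝ := fun z => C z / D z
  have ha : ∀ z, 0 < a z := fun z => div_pos (hC z) (hD z)
  have hroot : ∀ z, (1 - lam ^ 2) * a z ^ 2 - 2 * lam * A * a z - C z = 0 := by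
    intro z
    have hs := Real.sq_sqrt (hD0 z)
    have hz := (hD z).ne'
    have hDz : D z + lam * A = √(lam ^ 2 * A ^ 2 + (1 - lam ^ 2) * C z) := by simp [D]
    rw [← hDz] at hs
    exact root_aux hs hz
  let F : EuclideanSpace ℝ (Fin d) → Mink d := fun z =>
    (a z, ((lam + a z * A) / B) • (u : EuclideanSpace ℝ (Fin d)) + P z)
  have hF : ∀ z, lor (F z) (F z) = -1 ∧ 0 < (F z).1 := by
    intro z
    refine ⟨?_, ha z⟩
    have h2 : ‖(F z).2‖ ^ 2 = ((lam + a z * A) / B) ^ 2 + ‖P z‖ ^ 2 := by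
      simp only [F]
      rw [norm_add_sq_real, real_inner_smul_left, hPu, norm_smul, Real.norm_eq_abs, mul_pow,
        sq_abs]
      simp
    rw [lor_self, h2]
    have h3 := hroot z
    simp only [C] at h3
    simp only [F]
    exact norm_aux hBpos hAB h3
  let G : EuclideanSpace ℝ (Fin d) → HypSpace d := fun z => ⟨F z, hF z⟩
  have hG : Continuous G := by
    apply continuous_of_emb
    have hPc : Continuous P := by fun_prop
    have hCc : Continuous C := by fun_prop
    have hDc : Continuous D := by fun_prop
    have hac : Continuous a := hCc.div hDc fun z => (hD z).ne'
    change Continuous F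
    fun_prop
  have hrange : hyperplane lam s u = Set.range G := by
    ext x
    constructor
    · intro hx
      have hx' : B * inner ℝ (u : EuclideanSpace ℝ (Fin d)) x.emb.2 - A * x.emb.1 = lam := by
        rw [← hlor]; exact hx
      have hself := lor_emb_self x
      rw [lor_self] at hself
      have hpos := fst_emb_pos x
      set b : ℝ := inner ℝ (u : EuclideanSpace ℝ (Fin d)) x.emb.2 with hb
      have hdec : x.emb.2 = b • (u : EuclideanSpace ℝ (Fin d)) + P x.emb.2 := by
        simp [P, hb]
      have hnorm : ‖x.emb.2‖ ^ 2 = b ^ 2 + ‖P x.emb.2‖ ^ 2 := by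
        conv_lhs => rw [hdec]
        rw [norm_add_sq_real, real_inner_smul_left, hPu, norm_smul, Real.norm_eq_abs, mul_pow,
          sq_abs]
        simp
      have hbB : b * B = lam + x.emb.1 * A := by linarith
      have hq : (1 - lam ^ 2) * x.emb.1 ^ 2 - 2 * lam * A * x.emb.1 - C x.emb.2 = 0 := by
        simp only [C]
        have e : (b * B) ^ 2 = (lam + x.emb.1 * A) ^ 2 := by rw [hbB]
        have e2 : ‖P x.emb.2‖ ^ 2 = x.emb.1 ^ 2 - 1 - b ^ 2 := by linarith
        rw [e2]
        linear_combination e - (x.emb.1 ^ 2) * hAB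
      have hCa : C x.emb.2 / x.emb.1 = (1 - lam ^ 2) * x.emb.1 - 2 * lam * A := by
        field_simp; linarith
      have hCap : 0 < C x.emb.2 / x.emb.1 := div_pos (hC _) hpos
      have hsq : √(lam ^ 2 * A ^ 2 + (1 - lam ^ 2) * C x.emb.2) =
          (1 - lam ^ 2) * x.emb.1 - lam * A := by
        refine sqrt_aux ?_ hq
        have := mul_nonneg hm hpos.le
        linarith
      have hax : a x.emb.2 = x.emb.1 := by
        have : D x.emb.2 = C x.emb.2 / x.emb.1 := by
          simp only [D]; rw [hsq, hCa]; ring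
        simp only [a]; rw [this, div_div_cancel₀ (hC _).ne']
      refine ⟨x.emb.2, emb_injective (Prod.ext hax ?_)⟩
      change ((lam + a x.emb.2 * A) / B) • (u : EuclideanSpace ℝ (Fin d)) + P x.emb.2 = x.emb.2
      rw [hax, ← hbB, mul_div_cancel_right₀ _ hBpos.ne', ← hdec]
    · rintro ⟨z, rfl⟩
      change lor (F z) _ = lam
      rw [hlor]
      simp only [F, inner_add_right, hPu, real_inner_smul_right, inner_sphere_self]
      field_simp
      ring
  rw [hrange]
  exact isConnected_range hG

/-- The sets `H(s, u)` are `lam`-geodesic hyperplanes. -/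
lemma isLambdaGeodesic_hyperplane (h0 : 0 ≤ lam) (h1 : lam ≤ 1) :
    IsLambdaGeodesic lam (hyperplane lam s u) where
  connected := isConnected_hyperplane h0 h1
  closed := isClosed_hyperplane
  smooth := isSmoothHypersurface_hyperplane
  umbilic _ hp := ⟨_, isUmbilicAt_of_mem hp⟩

/-- The distance from `𝐨` to `H(s, u)` is `|s|`. -/
lemma infDist_hyperplane (h0 : 0 ≤ lam) (h1 : lam ≤ 1) :
    Metric.infDist origin (hyperplane lam s u) = |s| := by
  have hdist : ∀ x : HypSpace d, Real.cosh (dist origin x) = x.emb.1 := by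
    intro x; rw [cosh_dist]; simp [lor, origin, emb]
  have hgeo : dist origin (geo s u) = |s| := by
    have h := hdist (geo s u)
    have h2 : (geo s u).emb.1 = Real.cosh |s| := by simp [geo, emb]
    rw [h2] at h
    exact Real.cosh_injOn dist_nonneg (abs_nonneg s) h
  apply le_antisymm
  · rw [← hgeo]; exact Metric.infDist_le_dist_of_mem geo_mem_hyperplane
  · rw [Metric.le_infDist ⟨_, geo_mem_hyperplane⟩]
    intro x hx
    rw [← abs_of_nonneg (dist_nonneg (x := origin) (y := x)), ← Real.cosh_le_cosh, hdist]
    have hx' : lor x.emb (polar lam s u) = lam := hx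
    simp only [lor, polar_fst, polar_snd, real_inner_smul_right] at hx'
    have hB := polar_snd_coeff_pos (s := s) h0 h1
    have hself := lor_emb_self x
    rw [lor_self] at hself
    have hpos := fst_emb_pos x
    have hcs : (inner ℝ x.emb.2 (u : EuclideanSpace ℝ (Fin d)) : ℝ) ^ 2 ≤ x.emb.1 ^ 2 - 1 := by
      have h := abs_real_inner_le_norm x.emb.2 (u : EuclideanSpace ℝ (Fin d))
      have hu : ‖(u : EuclideanSpace ℝ (Fin d))‖ = 1 := by simp
      rw [hu, mul_one] at h
      have := sq_le_sq' (by linarith [neg_abs_le (inner ℝ x.emb.2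
        (u : EuclideanSpace ℝ (Fin d)) : ℝ)]) ((le_abs_self _).trans h)
      linarith
    set b : ℝ := inner ℝ x.emb.2 (u : EuclideanSpace ℝ (Fin d))
    set c := Real.cosh s
    set t := Real.sinh s
    have hct : c ^ 2 = t ^ 2 + 1 := Real.cosh_sq s
    have hc : 0 < c := Real.cosh_pos s
    have hq : 0 ≤ (x.emb.1 - c) *
        ((1 - lam ^ 2) * x.emb.1 + (1 + lam ^ 2) * c - 2 * lam * t) := by
      have e : ((c - lam * t) * b) ^ 2 = (lam + (t - lam * c) * x.emb.1) ^ 2 := by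
        congr 1; linarith
      have e2 := mul_le_mul_of_nonneg_left hcs (sq_nonneg (c - lam * t))
      have e3 : (x.emb.1 - c) * ((1 - lam ^ 2) * x.emb.1 + (1 + lam ^ 2) * c - 2 * lam * t) =
          (c - lam * t) ^ 2 * (x.emb.1 ^ 2 - 1) - (lam + (t - lam * c) * x.emb.1) ^ 2 := by
        linear_combination (-(x.emb.1 ^ 2 * (1 - lam ^ 2)) - lam ^ 2) * hct
      rw [e3, ← e, mul_pow]; linarith
    by_contra hlt
    push Not at hlt
    have hm : 0 ≤ 1 - lam ^ 2 := by nlinarith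
    have htc : |t| < c := by
      rw [← abs_of_pos hc]; exact sq_lt_sq.1 (by linarith)
    have : 0 < (1 + lam ^ 2) * c - 2 * lam * t := by
      have h3 : lam * t ≤ lam * |t| := mul_le_mul_of_nonneg_left (le_abs_self t) h0
      have h4 : lam * |t| ≤ lam * c := mul_le_mul_of_nonneg_left htc.le h0
      rcases h0.lt_or_eq with h | h
      · have h5 : lam * |t| < lam * c := mul_lt_mul_of_pos_left htc h
        nlinarith [mul_nonneg (sq_nonneg (1 - lam)) hc.le]
      · rw [← h]; linarith
    have := mul_nonneg hm hpos.le
    nlinarith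

end Hypersurfaces
/-! ### The invariant measure and the integrals `I_{lam,k}(R)` -/

/-- The space of `lam`-geodesic hyperplanes in `ℍ^d`, for `lam` in `[0, 1]`. -/
def Hyp (d : ℕ) (lam : unitInterval) : Type :=
  {H : Set (HypSpace d) // IsLambdaGeodesic lam H}

/-- The parametrization `(s, u) ↦ H(s, u)` of the `lam`-geodesic hyperplanes. -/
def param (d : ℕ) (lam : unitInterval)
    (q : ℝ × Metric.sphere (0 : EuclideanSpace ℝ (Fin d)) 1) : Hyp d lam :=
  ⟨hyperplane (lam : ℝ) q.1 q.2, isLambdaGeodesic_hyperplane lam.2.1 lam.2.2⟩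

/-- The measurable structure on the space of `lam`-geodesic hyperplanes given by the
parametrization: `f` is measurable iff `(s, u) ↦ f (H(s, u))` is. -/
instance (d : ℕ) (lam : unitInterval) : MeasurableSpace (Hyp d lam) :=
  MeasurableSpace.map (param d lam) inferInstance

lemma measurable_param (d : ℕ) (lam : unitInterval) : Measurable (param d lam) :=
  fun _ h => h

/-- The normalized surface measure on the unit sphere `S^{d-1}`. -/
def sphereProb (d : ℕ) : Measure (Metric.sphere (0 : EuclideanSpace ℝ (Fin d)) 1) :=
  ((volume : Measure (EuclideanSpace ℝ (Fin d))).toSphere Set.univ)⁻¹ •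
    (volume : Measure (EuclideanSpace ℝ (Fin d))).toSphere

/-- The isometry invariant measure `Λ_lam` on the space of `lam`-geodesic hyperplanes: the image
of `(cosh s - lam sinh s)^{d-1} ds du` under `(s, u) ↦ H(s, u)`. -/
def invMeasure (d : ℕ) (lam : unitInterval) : Measure (Hyp d lam) :=
  (((volume : Measure ℝ).prod (sphereProb d)).withDensity fun q =>
    ENNReal.ofReal ((Real.cosh q.1 - lam * Real.sinh q.1) ^ (d - 1))).map (param d lam)

/-- The integral `I_{lam,k}(R)` of the `k`-th power of the `(d-1)`-dimensional Hausdorff measure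
of `H ∩ B_R` with respect to `Λ_lam`, where `B_R` is the hyperbolic ball of radius `R` centred
at the origin. (`μHE[n]` is the `n`-dimensional Hausdorff measure for the hyperbolic distance,
normalized so as to agree with Lebesgue measure on `ℝ^n`.) -/
def cumulantIntegral (d : ℕ) (lam : unitInterval) (k : ℕ) (R : ℝ) : ℝ≥0∞ :=
  ∫⁻ H, (μHE[d - 1] (H.1 ∩ Metric.closedBall (origin : HypSpace d) R)) ^ k ∂(invMeasure d lam)

end LambdaHyp

end

noncomputable section

open Set Module

/-! ### Hausdorff measure of conformal images -/

section AreaFormula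

/-! Put `n = d - 1` and `m = 1 - lam ^ 2`. Intrinsically a `lam`-geodesic hyperplane is a space of
constant curvature `-m`: its stereographic chart over `geo s u` is conformal with factor `1 / (1 -
m/4 * |p|^2)` (`lor_chartVec`). In this chart the time coordinate is `cosh s + h * scale lam s` with
`scale lam s = cosh s - lam * sinh s` and a height `h` that depends only on `|p|`. Thus `H(s, u) ∩
B_R` is the cap `h ≤ Q`, where `Q = (cosh R - cosh s) / scale lam s`. An area formula for conformal
maps turns its Hausdorff measure into a radial integral `capVol`. This depends on `s` only, so that
`I_{lam,k}(R)` is the integral over `|s| ≤ R` of `(sphereArea n * capVol n m Q)^k * (scale lam s)^n`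
(`cumulantIntegral_eq`).

The four regimes show where this integral concentrates. In the height variable the radial volume
element is `√(2h + m h²)^(n-2) dh`, so for `n ≥ 2` and `m > 0` the cap volume behaves like `√m^(n-2)
* Q^(n-1) / (n-1)` (`capVol_bounds`). After division by `e^{k(n-1)R}` the integrand converges to a
multiple of `(scale lam s)^(-M)` with `M = k(n-1) - n`. As `scale lam s` is `√m` times a translate
of `cosh`, the limit is integrable for `M ≥ 1`; then hyperplanes at bounded distance dominate, and
the powers of `√m` add up to `n - k` (`isEquivalent_cumulantIntegral`). For `n ≥ 2`, `k ≥ 2` the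
only exception is `n = k = 2`, where `M = 0`.

In that case, and for horospheres with `k = 2`, the scale cancels exactly: the integrand is a
constant times `(cosh R - cosh s)^n`, nearly constant in `s` over most of `[-R, R]`, which produces
the factor `R`. For horospheres with `k > 2` the sections are Euclidean balls of radius `√(2Q)` and
the mass sits at bounded distance from `s = R`; the substitution `s = R - t` gives a convergent
limit.

In the plane with `lam < 1`, lengths grow only logarithmically in `Q` while the density grows like
`e^{|s|}`. The upper bound trades the `k`-th power of the logarithm for a square root. The lower
bound keeps only the strip `R - 2 ≤ s ≤ R - 1`, where the arcs have length at least a multiple of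
`(1 - lam)^(-1/2)` and the density is at least a multiple of `(1 - lam) e^R`. -/

lemma LipschitzOnWith.euclideanHausdorffMeasure_image_le {X Y : Type*} [MetricSpace X]
    [MeasurableSpace X] [BorelSpace X] [MetricSpace Y] [MeasurableSpace Y] [BorelSpace Y]
    {K : NNReal} {f : X → Y} {s : Set X} (h : LipschitzOnWith K f s) (n : ℕ) :
    μHE[n] (f '' s) ≤ (K : ℝ≥0∞) ^ n * μHE[n] s := by
  rw [Measure.euclideanHausdorffMeasure_def, Measure.euclideanHausdorffMeasure_def,
    Measure.smul_apply, Measure.smul_apply, ENNReal.smul_def, ENNReal.smul_def, smul_eq_mul,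
    smul_eq_mul, mul_left_comm]
  gcongr
  simpa using h.hausdorffMeasure_image_le (d := n) (by positivity)

variable {V X : Type*} [NormedAddCommGroup V] [MetricSpace X]

/-- `f` is infinitesimally a similarity of ratio `ρ x` at the point `x`. -/
def IsInfinitesimalSimilarityAt (f : V → X) (ρ : V → ℝ) (x : V) : Prop :=
  ∀ K : ℝ, 1 < K → ∃ W ∈ 𝓝 x, ∀ p ∈ W, ∀ q ∈ W,
    K⁻¹ * ρ x * dist p q ≤ dist (f p) (f q) ∧ dist (f p) (f q) ≤ K * ρ x * dist p q

lemma IsInfinitesimalSimilarityAt.continuousAt {f : V → X} {ρ : V → ℝ} {x : V}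
    (h : IsInfinitesimalSimilarityAt f ρ x) : ContinuousAt f x := by
  obtain ⟨W, hW, hd⟩ := h 2 (by norm_num)
  refine tendsto_iff_dist_tendsto_zero.2 ?_
  refine squeeze_zero' (Eventually.of_forall fun _ => dist_nonneg)
    (g := fun p => 2 * ρ x * dist p x) ?_ ?_
  · filter_upwards [hW] with p hp using (hd p hp x (mem_of_mem_nhds hW)).2
  · have : Continuous fun p => 2 * ρ x * dist p x := by fun_prop
    simpa using this.tendsto x

variable [InnerProductSpace ℝ V] [FiniteDimensional ℝ V] [MeasurableSpace V] [BorelSpace V]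
  [MeasurableSpace X] [BorelSpace X] {n : ℕ} {f : V → X} {ρ : V → ℝ}

/-- Near `x` both `f` and its inverse are Lipschitz, with constants `K * ρ x` and `K / ρ x`, and
Hausdorff measure scales by the `n`-th power of a Lipschitz constant. One factor `K` pays for this
distortion, the other for replacing `ρ x` by `ρ p`. -/
lemma IsInfinitesimalSimilarityAt.exists_measure_bounds (hn : finrank ℝ V = n) {x : V}
    (h : IsInfinitesimalSimilarityAt f ρ x) (hρ : ContinuousAt ρ x) (hx : 0 < ρ x)
    {K : ℝ} (hK : 1 < K) :
    ∃ W : Set V, IsOpen W ∧ x ∈ W ∧ ∀ T ⊆ W, MeasurableSet T →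
      μHE[n] (f '' T) ≤ ENNReal.ofReal ((K * K) ^ n) * ∫⁻ p in T, ENNReal.ofReal (ρ p ^ n) ∧
      ∫⁻ p in T, ENNReal.ofReal (ρ p ^ n) ≤ ENNReal.ofReal ((K * K) ^ n) * μHE[n] (f '' T) := by
  obtain ⟨W₀, hW₀, hd⟩ := h K hK
  have hK0 : 0 < K := by linarith
  have h1 : ∀ᶠ p in 𝓝 x, K⁻¹ * ρ x < ρ p :=
    hρ.eventually (lt_mem_nhds (by
      have : K⁻¹ < 1 := inv_lt_one_of_one_lt₀ hK
      nlinarith))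
  have h2 : ∀ᶠ p in 𝓝 x, ρ p < K * ρ x := hρ.eventually (gt_mem_nhds (by nlinarith))
  obtain ⟨W, hWs, hWo, hxW⟩ := mem_nhds_iff.1 (inter_mem hW₀ (inter_mem h1 h2))
  refine ⟨W, hWo, hxW, fun T hTW hT => ?_⟩
  have hV : (μHE[n] : Measure V) = volume := by
    rw [← hn]; exact InnerProductSpace.euclideanHausdorffMeasure_eq_volume
  have hconst : ∀ c : ℝ, ∫⁻ _ in T, ENNReal.ofReal (c ^ n) = ENNReal.ofReal (c ^ n) * volume T :=
    fun c => by simp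
  have lip1 : LipschitzOnWith (Real.toNNReal (K * ρ x)) f T :=
    LipschitzOnWith.of_dist_le_mul fun p hp q hq => by
      rw [Real.coe_toNNReal _ (by positivity)]
      exact (hd p (hWs (hTW hp)).1 q (hWs (hTW hq)).1).2
  have anti : ∀ p ∈ T, ∀ q ∈ T, dist p q ≤ K * (ρ x)⁻¹ * dist (f p) (f q) := by
    intro p hp q hq
    have := (hd p (hWs (hTW hp)).1 q (hWs (hTW hq)).1).1
    calc dist p q = K * (ρ x)⁻¹ * (K⁻¹ * ρ x * dist p q) := by field_simp
      _ ≤ _ := by gcongr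
  have inj : InjOn f T := fun p hp q hq hpq => by
    have := anti p hp q hq
    rw [hpq, dist_self, mul_zero] at this
    exact dist_le_zero.1 this
  have lip2 : LipschitzOnWith (Real.toNNReal (K * (ρ x)⁻¹)) (Function.invFunOn f T) (f '' T) := by
    refine LipschitzOnWith.of_dist_le_mul ?_
    rintro _ ⟨p, hp, rfl⟩ _ ⟨q, hq, rfl⟩
    rw [Real.coe_toNNReal _ (by positivity), inj.leftInvOn_invFunOn hp, inj.leftInvOn_invFunOn hq]
    exact anti p hp q hq
  have e1 := lip1.euclideanHausdorffMeasure_image_le n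
  have e2 := lip2.euclideanHausdorffMeasure_image_le n
  rw [inj.leftInvOn_invFunOn.image_image] at e2
  rw [hV] at e1 e2
  rw [← ENNReal.ofReal, ← ENNReal.ofReal_pow (by positivity)] at e1 e2
  constructor
  · calc μHE[n] (f '' T) ≤ ENNReal.ofReal ((K * ρ x) ^ n) * volume T := e1
      _ = ENNReal.ofReal ((K * K) ^ n) * ∫⁻ _ in T, ENNReal.ofReal ((K⁻¹ * ρ x) ^ n) := by
        rw [hconst, ← mul_assoc, ← ENNReal.ofReal_mul (by positivity), ← mul_pow]
        congr 3; field_simp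
      _ ≤ _ := by
        refine mul_le_mul_right ?_ _
        refine setLIntegral_mono' hT fun p hp => ?_
        have := (hWs (hTW hp)).2.1
        simp only [mem_ofPred_eq] at this
        gcongr
  · calc ∫⁻ p in T, ENNReal.ofReal (ρ p ^ n) ≤ ∫⁻ _ in T, ENNReal.ofReal ((K * ρ x) ^ n) := by
          refine setLIntegral_mono' hT fun p hp => ?_
          have := (hWs (hTW hp)).2.1
          have h3 := (hWs (hTW hp)).2.2
          simp only [mem_ofPred_eq] at this h3
          have : 0 ≤ ρ p := le_trans (by positivity) this.le
          gcongr
      _ ≤ ENNReal.ofReal ((K * ρ x) ^ n) *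
          (ENNReal.ofReal ((K * (ρ x)⁻¹) ^ n) * μHE[n] (f '' T)) := by
        rw [hconst]; gcongr
      _ = _ := by
        rw [← mul_assoc, ← ENNReal.ofReal_mul (by positivity), ← mul_pow]
        congr 3; field_simp

/-- The area formula for an injective map of an open subset of a Euclidean space to a metric space
which is infinitesimally a similarity of ratio `ρ`. -/
theorem euclideanHausdorffMeasure_image_eq_lintegral (hn : finrank ℝ V = n) {U : Set V}
    (hU : IsOpen U) (hρ : ContinuousOn ρ U) (hpos : ∀ x ∈ U, 0 < ρ x)
    (hf : ∀ x ∈ U, IsInfinitesimalSimilarityAt f ρ x) (hinj : InjOn f U)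
    {S : Set V} (hS : MeasurableSet S) (hSU : S ⊆ U) :
    μHE[n] (f '' S) = ∫⁻ x in S, ENNReal.ofReal (ρ x ^ n) := by
  have key : ∀ K : ℝ, 1 < K →
      μHE[n] (f '' S) ≤ ENNReal.ofReal ((K * K) ^ n) * ∫⁻ p in S, ENNReal.ofReal (ρ p ^ n) ∧
      ∫⁻ p in S, ENNReal.ofReal (ρ p ^ n) ≤ ENNReal.ofReal ((K * K) ^ n) * μHE[n] (f '' S) := by
    intro K hK
    rcases S.eq_empty_or_nonempty with rfl | ⟨x₀, hx₀⟩
    · simp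
    have hloc : ∀ x : S, _ := fun x => (hf x (hSU x.2)).exists_measure_bounds hn
      (hρ.continuousAt (hU.mem_nhds (hSU x.2))) (hpos x (hSU x.2)) hK
    choose W hWo hxW hW using hloc
    have : Nonempty S := ⟨⟨x₀, hx₀⟩⟩
    obtain ⟨t, htc, htU⟩ := TopologicalSpace.isOpen_iUnion_countable W hWo
    have hcov : S ⊆ ⋃ i ∈ t, W i := by
      rw [htU]; exact fun x hx => mem_iUnion.2 ⟨⟨x, hx⟩, hxW _⟩
    have htne : t.Nonempty := by
      obtain ⟨i, hi, -⟩ := mem_iUnion₂.1 (hcov hx₀); exact ⟨i, hi⟩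
    obtain ⟨e, he⟩ := htc.exists_eq_range htne
    -- By the Lindelöf property countably many of the neighbourhoods cover `S`. Made disjoint, they
    -- allow the local two-sided bounds to be summed.
    let A : ℕ → Set V := fun i => S ∩ disjointed (fun j => W (e j)) i
    have hAm : ∀ i, MeasurableSet (A i) := fun i =>
      hS.inter (MeasurableSet.disjointed (fun j => (hWo (e j)).measurableSet) i)
    have hAW : ∀ i, A i ⊆ W (e i) := fun i => inter_subset_right.trans (disjointed_subset _ _)
    have hAd : Pairwise (Function.onFun Disjoint A) := fun i j hij =>
      (disjoint_disjointed (fun j => W (e j)) hij).mono inter_subset_right inter_subset_right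
    have hAS : S = ⋃ i, A i := by
      rw [← inter_iUnion, iUnion_disjointed, eq_comm, inter_eq_left]
      rw [he, biUnion_range] at hcov
      exact hcov
    have hfc : ContinuousOn f U := fun x hx => (hf x hx).continuousAt.continuousWithinAt
    have hAU : ∀ i, A i ⊆ U := fun i => inter_subset_left.trans hSU
    have hsum1 : ∫⁻ p in S, ENNReal.ofReal (ρ p ^ n) =
        ∑' i, ∫⁻ p in A i, ENNReal.ofReal (ρ p ^ n) := by
      conv_lhs => rw [hAS]
      exact lintegral_iUnion hAm hAd _
    have hsum2 : μHE[n] (f '' S) = ∑' i, μHE[n] (f '' A i) := by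
      conv_lhs => rw [hAS, image_iUnion]
      -- Additivity on the image side needs measurable images: a continuous injection maps Borel
      -- subsets of `V` to Borel sets.
      refine measure_iUnion (fun i j hij => ?_) fun i =>
        (hAm i).image_of_continuousOn_injOn (hfc.mono (hAU i)) (hinj.mono (hAU i))
      exact (hAd hij).image hinj (hAU i) (hAU j)
    rw [hsum1, hsum2, ← ENNReal.tsum_mul_left, ← ENNReal.tsum_mul_left]
    exact ⟨ENNReal.tsum_le_tsum fun i => (hW (e i) (A i) (hAW i) (hAm i)).1,
      ENNReal.tsum_le_tsum fun i => (hW (e i) (A i) (hAW i) (hAm i)).2⟩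
  -- Let `K` decrease to `1`. Since the limit `1` of the coefficient is nonzero, the case `b = ∞`
  -- does no harm.
  have lim : ∀ a b : ℝ≥0∞, (∀ K : ℝ, 1 < K → a ≤ ENNReal.ofReal ((K * K) ^ n) * b) → a ≤ b := by
    intro a b hab
    have h1 : Tendsto (fun K : ℝ => ENNReal.ofReal ((K * K) ^ n)) (𝓝[>] 1) (𝓝 1) := by
      have : Continuous fun K : ℝ => ENNReal.ofReal ((K * K) ^ n) :=
        ENNReal.continuous_ofReal.comp (by fun_prop)
      simpa using (this.tendsto 1).mono_left nhdsWithin_le_nhds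
    have h2 := ENNReal.Tendsto.mul_const (b := b) h1 (Or.inl one_ne_zero)
    rw [one_mul] at h2
    refine ge_of_tendsto h2 ?_
    filter_upwards [self_mem_nhdsWithin] with K hK using hab K hK
  exact le_antisymm (lim _ _ fun K hK => (key K hK).1) (lim _ _ fun K hK => (key K hK).2)

end AreaFormula

namespace LambdaHyp

open HypSpace

section

/-! ### Conformal charts of the `lam`-geodesic hyperplanes -/

lemma sinh_le_mul_cosh {t : ℝ} (ht : 0 ≤ t) : Real.sinh t ≤ t * Real.cosh t := by
  have h : MonotoneOn (fun t : ℝ => t * Real.cosh t - Real.sinh t) (Ici 0) := by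
    refine monotoneOn_of_deriv_nonneg (convex_Ici 0) (by fun_prop) (by fun_prop) fun x hx => ?_
    rw [interior_Ici] at hx
    have : HasDerivAt (fun t : ℝ => t * Real.cosh t - Real.sinh t)
        (1 * Real.cosh x + x * Real.sinh x - Real.cosh x) x :=
      ((hasDerivAt_id x).mul (Real.hasDerivAt_cosh x)).sub (Real.hasDerivAt_sinh x)
    rw [this.deriv]
    have := mul_nonneg (le_of_lt hx) (Real.sinh_nonneg_iff.2 (le_of_lt hx))
    linarith
  have := h (mem_Ici.2 le_rfl) (mem_Ici.2 ht) ht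
  simp at this
  linarith

/-- Comparison of a hyperbolic distance `x` with the length `D` of the Lorentzian chord. -/
lemma chord_bounds {x D : ℝ} (hx : 0 ≤ x) (hD : 0 ≤ D) (h : Real.cosh x = 1 + D ^ 2 / 2) :
    x ≤ D ∧ D ≤ √(1 + D ^ 2 / 4) * x := by
  have h0 : Real.cosh x = 1 + 2 * Real.sinh (x / 2) ^ 2 := by
    have := Real.cosh_two_mul (x / 2)
    rw [mul_div_cancel₀ x two_ne_zero, Real.cosh_sq] at this
    linarith
  have hs : 0 ≤ Real.sinh (x / 2) := Real.sinh_nonneg_iff.2 (by linarith)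
  -- The chord of an arc of length `x` is `2 sinh (x/2)`, and the square root in the claim is `cosh
  -- (x/2)`.
  have h1 : D = 2 * Real.sinh (x / 2) := by
    refine (sq_eq_sq₀ hD (by positivity)).1 ?_
    linarith
  have h2 : √(1 + D ^ 2 / 4) = Real.cosh (x / 2) := by
    rw [Real.sqrt_eq_iff_mul_self_eq (by positivity) (Real.cosh_pos _).le, ← sq, Real.cosh_sq, h1]
    ring
  rw [h2, h1]
  constructor
  · have := Real.self_le_sinh_iff.2 (show 0 ≤ x / 2 by linarith)
    linarith
  · have := sinh_le_mul_cosh (show 0 ≤ x / 2 by linarith)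
    linarith

variable {d : ℕ}

/-- A map to hyperbolic space for which `cosh` of the distance is given by a conformal factor is
infinitesimally a similarity. -/
lemma isInfinitesimalSimilarityAt_of_cosh_dist {V : Type*} [NormedAddCommGroup V]
    {f : V → HypSpace d} {τ : V → ℝ} {U : Set V} (hU : IsOpen U) (hτ : Continuous τ)
    (hpos : ∀ p ∈ U, 0 < τ p)
    (hf : ∀ p ∈ U, ∀ q ∈ U,
      Real.cosh (dist (f p) (f q)) = 1 + dist p q ^ 2 / (2 * τ p * τ q)) {x : V} (hx : x ∈ U) :
    IsInfinitesimalSimilarityAt f (fun p => (τ p)⁻¹) x := by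
  intro K hK
  have hτx := hpos x hx
  -- `g` is the geometric mean of the two conformal factors and `D` the Lorentzian chord. On the
  -- diagonal at `x` they equal `1 / τ x` and `0`, so `e1` and `e2` are continuity statements; they
  -- yield the upper and the lower estimate respectively.
  let g : V × V → ℝ := fun z => √((τ z.1 * τ z.2)⁻¹)
  let D : V × V → ℝ := fun z => g z * dist z.1 z.2
  have hg : ContinuousAt g (x, x) := by
    refine Real.continuous_sqrt.continuousAt.comp (ContinuousAt.inv₀ (by fun_prop) ?_)
    exact (mul_pos hτx hτx).ne'
  have hD : ContinuousAt D (x, x) := hg.mul (by fun_prop)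
  have hgx : g (x, x) = (τ x)⁻¹ := by
    simp only [g]
    rw [mul_inv, Real.sqrt_mul_self (by positivity)]
  have hDx : D (x, x) = 0 := by simp [D]
  have hb : ContinuousAt (fun z => K * g z) (x, x) := continuousAt_const.mul hg
  have ha : ContinuousAt (fun z => √(1 + D z ^ 2 / 4)) (x, x) :=
    Real.continuous_sqrt.continuousAt.comp (by fun_prop)
  have hK0 : 0 < K := by linarith
  have e1 : ∀ᶠ z in 𝓝 (x, x), g z < K * (τ x)⁻¹ :=
    hg.eventually (gt_mem_nhds (by rw [hgx]; have := inv_pos.2 hτx; nlinarith))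
  have e2 : ∀ᶠ z in 𝓝 (x, x), √(1 + D z ^ 2 / 4) * (τ x)⁻¹ < K * g z := by
    refine (ha.mul continuousAt_const).eventually_lt hb ?_
    simp only [Pi.mul_apply]
    rw [hDx, hgx]
    have := inv_pos.2 hτx
    simp
    nlinarith
  have e := e1.and e2
  rw [nhds_prod_eq] at e
  obtain ⟨W, hW, hWe⟩ := mem_prod_same_iff.1 e
  refine ⟨W ∩ U, inter_mem hW (hU.mem_nhds hx), fun p hp q hq => ?_⟩
  have hz := hWe (mk_mem_prod hp.1 hq.1)
  have hpp := hpos p hp.2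
  have hqq := hpos q hq.2
  have hDn : 0 ≤ D (p, q) := by positivity
  have hch := chord_bounds (x := dist (f p) (f q)) (D := D (p, q)) dist_nonneg hDn (by
    rw [hf p hp.2 q hq.2]
    simp only [D, g]
    rw [mul_pow, Real.sq_sqrt (by positivity)]
    field_simp)
  obtain ⟨z1, z2⟩ := hz
  constructor
  · have hs : 0 < √(1 + D (p, q) ^ 2 / 4) := by positivity
    rw [← mul_le_mul_iff_right₀ hs]
    refine le_trans ?_ hch.2
    calc √(1 + D (p, q) ^ 2 / 4) * (K⁻¹ * (τ x)⁻¹ * dist p q)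
        = (√(1 + D (p, q) ^ 2 / 4) * (τ x)⁻¹) * (K⁻¹ * dist p q) := by ring
      _ ≤ (K * g (p, q)) * (K⁻¹ * dist p q) := by gcongr
      _ = D (p, q) := by simp only [D]; field_simp
  · refine hch.1.trans ?_
    simp only [D]
    gcongr

variable (lam s : ℝ) (u : Metric.sphere (0 : EuclideanSpace ℝ (Fin d)) 1)

/-- The domain of the conformal charts: the orthogonal complement of `u`. -/
abbrev TanSpace : Type := ((ℝ ∙ (u : EuclideanSpace ℝ (Fin d)))ᗮ : Submodule ℝ _)

variable {u}

/-- The inverse of the conformal factor of the chart. -/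
def chartDenom (p : TanSpace u) : ℝ := 1 - (1 - lam ^ 2) / 4 * ‖p‖ ^ 2

/-- The height of a point of the chart over `geo s u`. -/
def chartHeight (p : TanSpace u) : ℝ := ‖p‖ ^ 2 / (2 * chartDenom lam p)

/-- The stereographic parametrization of `H(s, u)`, as a map to Minkowski space. -/
def chartVec (p : TanSpace u) : Mink d :=
  (Real.cosh s + chartHeight lam p * (Real.cosh s - lam * Real.sinh s),
    (Real.sinh s + chartHeight lam p * (Real.sinh s - lam * Real.cosh s)) •
      (u : EuclideanSpace ℝ (Fin d)) + (chartDenom lam p)⁻¹ • (p : EuclideanSpace ℝ (Fin d)))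

lemma continuous_chartDenom : Continuous (chartDenom lam : TanSpace u → ℝ) := by
  unfold chartDenom; fun_prop

lemma inner_tanSpace (p : TanSpace u) :
    inner ℝ (u : EuclideanSpace ℝ (Fin d)) (p : EuclideanSpace ℝ (Fin d)) = (0 : ℝ) :=
  Submodule.mem_orthogonal_singleton_iff_inner_right.1 p.2

/-- With `γ = geo s u`, height `h` and `τ = chartDenom`, the chart is `γ + h (γ - lam γ') + p / τ`.
Here `⟨γ, γ - lam γ'⟩ = -1` and `γ - lam γ'` has square `-(1 - lam ^ 2)`, which gives `key`. The
choice of `τ` and `h` makes the height terms combine to `(|p|² + |q|²) / (2 τ(p) τ(q))`, and the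
mixed term completes the square `|p - q|²`. This is the chord formula of the conformal ball model of
curvature `-(1 - lam ^ 2)`, flat for `lam = 1`. -/
lemma lor_chartVec {p q : TanSpace u} (hp : chartDenom lam p ≠ 0) (hq : chartDenom lam q ≠ 0) :
    -lor (chartVec lam s p) (chartVec lam s q) =
      1 + dist p q ^ 2 / (2 * chartDenom lam p * chartDenom lam q) := by
  have h1 := inner_tanSpace p
  have h2 := inner_tanSpace q
  have h1' : inner ℝ (p : EuclideanSpace ℝ (Fin d)) (u : EuclideanSpace ℝ (Fin d)) = (0 : ℝ) := by
    rw [real_inner_comm]; exact h1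
  have hd : dist p q ^ 2 = ‖p‖ ^ 2 - 2 * inner ℝ (p : EuclideanSpace ℝ (Fin d))
      (q : EuclideanSpace ℝ (Fin d)) + ‖q‖ ^ 2 := by
    rw [dist_eq_norm, norm_sub_sq_real]; rfl
  have hc := Real.cosh_sq s
  simp only [lor, chartVec, inner_add_left, inner_add_right, real_inner_smul_left,
    real_inner_smul_right, h1', h2, inner_sphere_self, hd]
  set i : ℝ := inner ℝ (p : EuclideanSpace ℝ (Fin d)) (q : EuclideanSpace ℝ (Fin d))
  have key : -((Real.sinh s + chartHeight lam p * (Real.sinh s - lam * Real.cosh s)) *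
      (Real.sinh s + chartHeight lam q * (Real.sinh s - lam * Real.cosh s))
      - (Real.cosh s + chartHeight lam p * (Real.cosh s - lam * Real.sinh s)) *
      (Real.cosh s + chartHeight lam q * (Real.cosh s - lam * Real.sinh s))) =
      1 + chartHeight lam p + chartHeight lam q +
        (1 - lam ^ 2) * (chartHeight lam p * chartHeight lam q) := by
    linear_combination (1 + chartHeight lam p + chartHeight lam q +
        (1 - lam ^ 2) * (chartHeight lam p * chartHeight lam q)) * hc
  have key2 : chartHeight lam p + chartHeight lam q +
        (1 - lam ^ 2) * (chartHeight lam p * chartHeight lam q) =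
        (‖p‖ ^ 2 + ‖q‖ ^ 2) / (2 * chartDenom lam p * chartDenom lam q) := by
    have e1 : ‖p‖ ^ 2 * chartDenom lam q + ‖q‖ ^ 2 * chartDenom lam p
        + (1 - lam ^ 2) * ‖p‖ ^ 2 * ‖q‖ ^ 2 / 2 = ‖p‖ ^ 2 + ‖q‖ ^ 2 := by
      simp only [chartDenom]; ring
    rw [← e1]
    simp only [chartHeight]
    field_simp
  have key3 : (‖p‖ ^ 2 - 2 * i + ‖q‖ ^ 2) / (2 * chartDenom lam p * chartDenom lam q) =
      (‖p‖ ^ 2 + ‖q‖ ^ 2) / (2 * chartDenom lam p * chartDenom lam q)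
        - (chartDenom lam p)⁻¹ * ((chartDenom lam q)⁻¹ * i) := by
    field_simp; ring
  rw [key3]
  linear_combination key + key2

variable {lam}

lemma chartHeight_nonneg {p : TanSpace u} (hp : 0 < chartDenom lam p) :
    0 ≤ chartHeight lam p := by
  unfold chartHeight; positivity

lemma chartVec_mem (h0 : 0 ≤ lam) (h1 : lam ≤ 1) {p : TanSpace u} (hp : 0 < chartDenom lam p) :
    lor (chartVec lam s p) (chartVec lam s p) = -1 ∧ 0 < (chartVec lam s p).1 := by
  constructor
  · have := lor_chartVec lam s hp.ne' hp.ne'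
    rw [dist_self] at this
    simp at this
    linarith
  · have h2 := chartHeight_nonneg hp
    have h3 := polar_snd_coeff_pos (s := s) h0 h1
    have := Real.cosh_pos s
    simp only [chartVec]
    positivity

open Classical in
/-- The stereographic parametrization of `H(s, u)` (with a junk value off its domain). -/
def chart (h0 : 0 ≤ lam) (h1 : lam ≤ 1) (p : TanSpace u) : HypSpace d :=
  if hp : 0 < chartDenom lam p then ⟨chartVec lam s p, chartVec_mem s h0 h1 hp⟩ else origin

lemma emb_chart (h0 : 0 ≤ lam) (h1 : lam ≤ 1) {p : TanSpace u} (hp : 0 < chartDenom lam p) :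
    (chart s h0 h1 p).emb = chartVec lam s p :=
  congrArg HypSpace.emb (dif_pos hp : chart s h0 h1 p = ⟨_, chartVec_mem s h0 h1 hp⟩)

lemma cosh_dist_chart (h0 : 0 ≤ lam) (h1 : lam ≤ 1) {p q : TanSpace u}
    (hp : 0 < chartDenom lam p) (hq : 0 < chartDenom lam q) :
    Real.cosh (dist (chart s h0 h1 p) (chart s h0 h1 q)) =
      1 + dist p q ^ 2 / (2 * chartDenom lam p * chartDenom lam q) := by
  rw [cosh_dist, emb_chart s h0 h1 hp, emb_chart s h0 h1 hq, lor_chartVec lam s hp.ne' hq.ne']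

lemma injOn_chart (h0 : 0 ≤ lam) (h1 : lam ≤ 1) :
    InjOn (chart s h0 h1 : TanSpace u → HypSpace d) {p | 0 < chartDenom lam p} := by
  intro p hp q hq hpq
  have hp : 0 < chartDenom lam p := hp
  have hq : 0 < chartDenom lam q := hq
  have := cosh_dist_chart s h0 h1 hp hq
  rw [hpq, dist_self, Real.cosh_zero] at this
  have h2 : dist p q ^ 2 / (2 * chartDenom lam p * chartDenom lam q) = 0 := by linarith
  rw [div_eq_zero_iff] at h2
  rcases h2 with h2 | h2
  · exact dist_eq_zero.1 (pow_eq_zero_iff two_ne_zero |>.1 h2)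
  · exact absurd h2 (by positivity)

lemma chart_mem_hyperplane (h0 : 0 ≤ lam) (h1 : lam ≤ 1) {p : TanSpace u}
    (hp : 0 < chartDenom lam p) : chart s h0 h1 p ∈ hyperplane lam s u := by
  have h2 := inner_tanSpace p
  have h2' : inner ℝ (p : EuclideanSpace ℝ (Fin d)) (u : EuclideanSpace ℝ (Fin d)) = (0 : ℝ) := by
    rw [real_inner_comm]; exact h2
  change lor (chart s h0 h1 p).emb (polar lam s u) = lam
  rw [emb_chart s h0 h1 hp]
  simp only [lor, polar_fst, polar_snd, chartVec, inner_add_left, real_inner_smul_left,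
    real_inner_smul_right, h2', inner_sphere_self]
  linear_combination lam * Real.cosh_sq s

/-! ### Surjectivity of the charts and sections by balls -/

lemma dist_origin_le_iff {x : HypSpace d} {R : ℝ} (hR : 0 ≤ R) :
    dist x origin ≤ R ↔ x.emb.1 ≤ Real.cosh R := by
  have : x.emb.1 = Real.cosh (dist x origin) := by
    rw [cosh_dist]; simp [lor, origin, emb]
  rw [this, Real.cosh_le_cosh, abs_of_nonneg dist_nonneg, abs_of_nonneg hR]

lemma cosh_le_of_mem_hyperplane (h0 : 0 ≤ lam) (h1 : lam ≤ 1) {x : HypSpace d}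
    (hx : x ∈ hyperplane lam s u) : Real.cosh s ≤ x.emb.1 := by
  have h2 : |s| ≤ dist origin x := by
    rw [← infDist_hyperplane (s := s) (u := u) h0 h1]; exact Metric.infDist_le_dist_of_mem hx
  rw [dist_comm] at h2
  have : x.emb.1 = Real.cosh (dist x origin) := by
    rw [cosh_dist]; simp [lor, origin, emb]
  rw [this, Real.cosh_le_cosh, abs_of_nonneg (dist_nonneg (x := x))]
  exact h2

/-- The time coordinate of `x` determines its height `q`, which is nonnegative because no point of
`H(s, u)` is closer to the origin than `|s|`. The equation of the hyperplane then fixes the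
component along `u`. The remaining component `v` must be `p / τ`, which is inverted explicitly. -/
lemma exists_chart_eq (h0 : 0 ≤ lam) (h1 : lam ≤ 1) {x : HypSpace d}
    (hx : x ∈ hyperplane lam s u) :
    ∃ p : TanSpace u, 0 < chartDenom lam p ∧ chart s h0 h1 p = x := by
  have hxc := cosh_le_of_mem_hyperplane s h0 h1 hx
  have hB := polar_snd_coeff_pos (s := s) h0 h1
  have hx' : lor x.emb (polar lam s u) = lam := hx
  simp only [lor, polar_fst, polar_snd, real_inner_smul_right] at hx'
  have hself := lor_emb_self x
  rw [lor_self] at hself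
  set b : ℝ := inner ℝ x.emb.2 (u : EuclideanSpace ℝ (Fin d)) with hb
  set c := Real.cosh s with hcdef
  set t := Real.sinh s with htdef
  have hc : c ^ 2 = t ^ 2 + 1 := Real.cosh_sq s
  obtain ⟨q, hq⟩ : ∃ q, q = (x.emb.1 - c) / (c - lam * t) := ⟨_, rfl⟩
  have hq0 : 0 ≤ q := hq ▸ div_nonneg (by linarith) hB.le
  have hx1 : x.emb.1 = c + q * (c - lam * t) := by rw [hq]; field_simp; ring
  have hbt : b = t + q * (t - lam * c) := by
    have : (c - lam * t) * b = (c - lam * t) * (t + q * (t - lam * c)) := by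
      rw [hx1] at hx'
      linear_combination hx' - lam * hc
    exact mul_left_cancel₀ hB.ne' this
  have hvm : x.emb.2 - b • (u : EuclideanSpace ℝ (Fin d)) ∈
      (ℝ ∙ (u : EuclideanSpace ℝ (Fin d)))ᗮ := by
    rw [Submodule.mem_orthogonal_singleton_iff_inner_left, inner_sub_left, real_inner_smul_left,
      inner_sphere_self, ← hb]; ring
  let v : TanSpace u := ⟨_, hvm⟩
  have hv : ‖v‖ ^ 2 = 2 * q + (1 - lam ^ 2) * q ^ 2 := by
    have e : ‖v‖ = ‖x.emb.2 - b • (u : EuclideanSpace ℝ (Fin d))‖ := rfl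
    rw [e, norm_sub_sq_real, real_inner_smul_right, ← hb, norm_smul, Real.norm_eq_abs, mul_pow,
      sq_abs]
    have hu : ‖(u : EuclideanSpace ℝ (Fin d))‖ = 1 := by simp
    rw [hu]
    have e2 : ‖x.emb.2‖ ^ 2 = x.emb.1 ^ 2 - 1 := by linarith
    rw [e2, hx1, hbt]
    linear_combination (1 + 2 * q + (1 - lam ^ 2) * q ^ 2) * hc
  have hm : 0 ≤ 1 - lam ^ 2 := by nlinarith
  have hk : 0 < 1 + (1 - lam ^ 2) * q / 2 := by positivity
  -- In terms of the height, `1 / τ = 1 + (1 - lam ^ 2) * q / 2`, so this is `τ • v`.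
  let p : TanSpace u := (1 + (1 - lam ^ 2) * q / 2)⁻¹ • v
  have hpn : ‖p‖ ^ 2 = 2 * q / (1 + (1 - lam ^ 2) * q / 2) := by
    rw [norm_smul, mul_pow, hv, Real.norm_eq_abs, sq_abs]
    field_simp
  have hden : chartDenom lam p = (1 + (1 - lam ^ 2) * q / 2)⁻¹ := by
    simp only [chartDenom, hpn]; field_simp; ring
  have hpos : 0 < chartDenom lam p := by rw [hden]; positivity
  have hhe : chartHeight lam p = q := by
    simp only [chartHeight, hpn, hden]; field_simp
  refine ⟨p, hpos, emb_injective ?_⟩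
  rw [emb_chart s h0 h1 hpos]
  refine Prod.ext ?_ ?_
  · simp only [chartVec, hhe]; exact hx1.symm
  · simp only [chartVec, hhe]
    have : (p : EuclideanSpace ℝ (Fin d)) = (1 + (1 - lam ^ 2) * q / 2)⁻¹ •
      (x.emb.2 - b • (u : EuclideanSpace ℝ (Fin d))) := rfl
    rw [this, hden, inv_inv, smul_inv_smul₀ hk.ne', ← hcdef, ← htdef, ← hbt]
    abel

/-- The radius of the ball which is mapped by the chart to `H(s, u) ∩ B_R`. -/
def chartRadius (m Q : ℝ) : ℝ := √(2 * Q / (1 + m * Q / 2))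

lemma chartRadius_nonneg (m Q : ℝ) : 0 ≤ chartRadius m Q := Real.sqrt_nonneg _

lemma chartRadius_sq {m Q : ℝ} (hm : 0 ≤ m) (hQ : 0 ≤ Q) :
    chartRadius m Q ^ 2 = 2 * Q / (1 + m * Q / 2) := Real.sq_sqrt (by positivity)

lemma chartRadius_denom {m Q : ℝ} (hm : 0 ≤ m) (hQ : 0 ≤ Q) :
    1 - m / 4 * chartRadius m Q ^ 2 = (1 + m * Q / 2)⁻¹ := by
  have : 0 < 1 + m * Q / 2 := by positivity
  rw [chartRadius_sq hm hQ]; field_simp; ring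

/-- The height increases with `|p|` on the chart domain, and `|p|² / (2τ) = Q` is linear in `|p|²`
with solution `2Q / (1 + mQ/2)`, where `m = 1 - lam ^ 2`. If `m > 0` this is below `4 / m`, so the
ball stays inside the domain. -/
lemma chartDenom_pos_and_height_le_iff (h0 : 0 ≤ lam) (h1 : lam ≤ 1) {Q : ℝ} (hQ : 0 ≤ Q)
    {p : TanSpace u} : 0 < chartDenom lam p ∧ chartHeight lam p ≤ Q ↔
      p ∈ Metric.closedBall 0 (chartRadius (1 - lam ^ 2) Q) := by
  have hm : 0 ≤ 1 - lam ^ 2 := by nlinarith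
  have hk : 0 < 1 + (1 - lam ^ 2) * Q / 2 := by positivity
  rw [mem_closedBall_zero_iff, ← sq_le_sq₀ (norm_nonneg _) (chartRadius_nonneg _ _),
    chartRadius_sq hm hQ, le_div_iff₀ hk]
  constructor
  · rintro ⟨hp, hh⟩
    rw [chartHeight, div_le_iff₀ (by positivity)] at hh
    simp only [chartDenom] at hh
    nlinarith
  · intro h
    have hp : 0 < chartDenom lam p := by
      simp only [chartDenom]
      rcases hm.eq_or_lt with e | e
      · rw [← e]; norm_num
      · have h3 : ‖p‖ ^ 2 * (1 - lam ^ 2) / 4 * (1 + (1 - lam ^ 2) * Q / 2) ≤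
            (1 - lam ^ 2) * Q / 2 := by nlinarith
        by_contra hcon
        push Not at hcon
        nlinarith
    refine ⟨hp, ?_⟩
    rw [chartHeight, div_le_iff₀ (by positivity)]
    simp only [chartDenom]
    nlinarith

/-- The distance from the origin is read off from the time coordinate, which on the chart is `cosh
s` plus the height times `cosh s - lam * sinh s`. Lying in the ball is therefore an upper bound on
the height. -/
lemma hyperplane_inter_closedBall (h0 : 0 ≤ lam) (h1 : lam ≤ 1) {R : ℝ} (hs : |s| ≤ R) :
    hyperplane lam s u ∩ Metric.closedBall origin R =
      chart s h0 h1 '' Metric.closedBall (0 : TanSpace u) (chartRadius (1 - lam ^ 2)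
        ((Real.cosh R - Real.cosh s) / (Real.cosh s - lam * Real.sinh s))) := by
  have hR : 0 ≤ R := (abs_nonneg s).trans hs
  have hB := polar_snd_coeff_pos (s := s) h0 h1
  have hcs : Real.cosh s ≤ Real.cosh R := by
    rw [Real.cosh_le_cosh, abs_of_nonneg hR]; exact hs
  have hQ : 0 ≤ (Real.cosh R - Real.cosh s) / (Real.cosh s - lam * Real.sinh s) :=
    div_nonneg (by linarith) hB.le
  ext x
  constructor
  · rintro ⟨hx, hxR⟩
    obtain ⟨p, hp, rfl⟩ := exists_chart_eq s h0 h1 hx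
    refine ⟨p, (chartDenom_pos_and_height_le_iff h0 h1 hQ).1 ⟨hp, ?_⟩, rfl⟩
    rw [Metric.mem_closedBall, dist_origin_le_iff hR, emb_chart s h0 h1 hp] at hxR
    simp only [chartVec] at hxR
    rw [le_div_iff₀ hB]
    linarith
  · rintro ⟨p, hp, rfl⟩
    obtain ⟨hp, hh⟩ := (chartDenom_pos_and_height_le_iff h0 h1 hQ).2 hp
    refine ⟨chart_mem_hyperplane s h0 h1 hp, ?_⟩
    rw [Metric.mem_closedBall, dist_origin_le_iff hR, emb_chart s h0 h1 hp]
    simp only [chartVec]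
    rw [le_div_iff₀ hB] at hh
    linarith

lemma hyperplane_inter_closedBall_eq_empty (h0 : 0 ≤ lam) (h1 : lam ≤ 1) {R : ℝ} (hs : R < |s|) :
    hyperplane lam s u ∩ Metric.closedBall origin R = ∅ := by
  refine eq_empty_of_forall_notMem fun x hx => ?_
  have h2 : |s| ≤ dist origin x := by
    rw [← infDist_hyperplane (s := s) (u := u) h0 h1]
    exact Metric.infDist_le_dist_of_mem hx.1
  have h3 := Metric.mem_closedBall.1 hx.2
  rw [dist_comm] at h3
  linarith

lemma finrank_tanSpace (hd : 1 ≤ d) : finrank ℝ (TanSpace u) = d - 1 := by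
  have : Fact (finrank ℝ (EuclideanSpace ℝ (Fin d)) = d - 1 + 1) := ⟨by simp; omega⟩
  exact Submodule.finrank_orthogonal_span_singleton (ne_zero_of_mem_unit_sphere u)

lemma euclideanHausdorffMeasure_hyperplane_inter (hd : 1 ≤ d) (h0 : 0 ≤ lam) (h1 : lam ≤ 1)
    {R : ℝ} (hs : |s| ≤ R) :
    μHE[d - 1] (hyperplane lam s u ∩ Metric.closedBall origin R) =
      ∫⁻ p : TanSpace u in Metric.closedBall 0 (chartRadius (1 - lam ^ 2)
        ((Real.cosh R - Real.cosh s) / (Real.cosh s - lam * Real.sinh s))),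
        ENNReal.ofReal ((chartDenom lam p)⁻¹ ^ (d - 1)) := by
  have hR : 0 ≤ R := (abs_nonneg s).trans hs
  have hB := polar_snd_coeff_pos (s := s) h0 h1
  have hcs : Real.cosh s ≤ Real.cosh R := by
    rw [Real.cosh_le_cosh, abs_of_nonneg hR]; exact hs
  have hQ : 0 ≤ (Real.cosh R - Real.cosh s) / (Real.cosh s - lam * Real.sinh s) :=
    div_nonneg (by linarith) hB.le
  have hU : IsOpen {p : TanSpace u | 0 < chartDenom lam p} :=
    isOpen_lt continuous_const (continuous_chartDenom lam)
  rw [hyperplane_inter_closedBall s h0 h1 hs]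
  refine euclideanHausdorffMeasure_image_eq_lintegral (finrank_tanSpace hd)
    (U := {p : TanSpace u | 0 < chartDenom lam p}) (ρ := fun p => (chartDenom lam p)⁻¹) hU ?_ ?_ ?_
    (injOn_chart s h0 h1) Metric.isClosed_closedBall.measurableSet ?_
  · exact (continuous_chartDenom lam).continuousOn.inv₀ fun p hp => ne_of_gt hp
  · exact fun p hp => inv_pos.2 hp
  · exact fun p hp => isInfinitesimalSimilarityAt_of_cosh_dist hU (continuous_chartDenom lam)
      (fun p hp => hp) (fun p hp q hq => cosh_dist_chart s h0 h1 hp hq) hp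
  · exact fun p hp => ((chartDenom_pos_and_height_le_iff h0 h1 hQ).2 hp).1

end

section

/-! ### The volume of the sections and reduction to an integral over the real line -/

/-- The radial part of the volume of a ball of radius `y` in the conformal ball model of
curvature `-m`. -/
def radialVol (n : ℕ) (m y : ℝ) : ℝ≥0∞ :=
  ∫⁻ t in Ioc 0 y, ENNReal.ofReal (t ^ (n - 1) * (1 - m / 4 * t ^ 2)⁻¹ ^ n)

/-- The radial part of the volume of `H ∩ B_R` for a section `H` of height `Q`. -/
def capVol (n : ℕ) (m Q : ℝ) : ℝ := (radialVol n m (chartRadius m Q)).toReal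

lemma measurable_capVol (n : ℕ) (m : ℝ) : Measurable (capVol n m) := by
  have h1 : Monotone (radialVol n m) := fun a b hab =>
    lintegral_mono_set (Ioc_subset_Ioc_right hab)
  have h2 : Measurable (chartRadius m) := by unfold chartRadius; fun_prop
  exact (h1.measurable.comp h2).ennreal_toReal

lemma capVol_nonneg (n : ℕ) (m Q : ℝ) : 0 ≤ capVol n m Q := ENNReal.toReal_nonneg

lemma denom_pos_of_le_chartRadius {m Q t : ℝ} (hm : 0 ≤ m) (hQ : 0 ≤ Q) (ht : 0 ≤ t)
    (h : t ≤ chartRadius m Q) : 0 < 1 - m / 4 * t ^ 2 := by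
  have h1 := chartRadius_denom hm hQ
  have h2 : 0 < (1 + m * Q / 2)⁻¹ := by positivity
  have h3 : t ^ 2 ≤ chartRadius m Q ^ 2 := by gcongr
  nlinarith

lemma continuousOn_radial {m Q : ℝ} (n : ℕ) (hm : 0 ≤ m) (hQ : 0 ≤ Q) :
    ContinuousOn (fun t : ℝ => t ^ (n - 1) * (1 - m / 4 * t ^ 2)⁻¹ ^ n)
      (Icc 0 (chartRadius m Q)) := by
  refine ContinuousOn.mul (by fun_prop) (ContinuousOn.pow (ContinuousOn.inv₀ (by fun_prop) ?_) _)
  exact fun t ht => (denom_pos_of_le_chartRadius hm hQ ht.1 ht.2).ne'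

lemma capVol_eq {m Q : ℝ} (n : ℕ) (hm : 0 ≤ m) (hQ : 0 ≤ Q) :
    capVol n m Q = ∫ t in (0)..(chartRadius m Q), t ^ (n - 1) * (1 - m / 4 * t ^ 2)⁻¹ ^ n := by
  rw [intervalIntegral.integral_of_le (chartRadius_nonneg _ _), integral_eq_lintegral_of_nonneg_ae]
  · rfl
  · filter_upwards [ae_restrict_mem measurableSet_Ioc] with t ht
    have := denom_pos_of_le_chartRadius hm hQ ht.1.le ht.2
    have := ht.1
    simp only [Pi.zero_apply]
    positivity
  · exact ((continuousOn_radial n hm hQ).mono Ioc_subset_Icc_self).aestronglyMeasurable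
      measurableSet_Ioc

/-- The surface area of the unit sphere of `ℝ^n`. -/
def sphereArea (n : ℕ) : ℝ := n * (√Real.pi ^ n / Real.Gamma (n / 2 + 1))

lemma sphereArea_pos {n : ℕ} (hn : 1 ≤ n) : 0 < sphereArea n := by
  have : 0 < Real.Gamma ((n : ℝ) / 2 + 1) := Real.Gamma_pos_of_pos (by positivity)
  have h2 : (0 : ℝ) < n := by exact_mod_cast hn
  have := Real.pi_pos
  unfold sphereArea
  positivity

/-- Polar coordinates. The closed ball is compact and avoids the zeros of the denominator, so the
integral is finite and the passage to real integrals loses nothing. -/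
lemma lintegral_closedBall_conformal {V : Type*} [NormedAddCommGroup V] [InnerProductSpace ℝ V]
    [FiniteDimensional ℝ V] [MeasurableSpace V] [BorelSpace V] {n : ℕ} (hn : finrank ℝ V = n)
    (hn1 : 1 ≤ n) {m Q : ℝ} (hm : 0 ≤ m) (hQ : 0 ≤ Q) :
    ∫⁻ p in Metric.closedBall (0 : V) (chartRadius m Q),
      ENNReal.ofReal ((1 - m / 4 * ‖p‖ ^ 2)⁻¹ ^ n) =
    ENNReal.ofReal (sphereArea n * capVol n m Q) := by
  have : Nontrivial V := by
    refine nontrivial_of_finrank_pos (R := ℝ) (by omega)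
  set P := chartRadius m Q with hP
  let g : ℝ → ℝ := fun t => (1 - m / 4 * t ^ 2)⁻¹ ^ n
  have hdpos : ∀ p ∈ Metric.closedBall (0 : V) P, 0 < 1 - m / 4 * ‖p‖ ^ 2 := fun p hp =>
    denom_pos_of_le_chartRadius hm hQ (norm_nonneg p) (mem_closedBall_zero_iff.1 hp)
  have hcont : ContinuousOn (fun p : V => g ‖p‖) (Metric.closedBall 0 P) := by
    refine ContinuousOn.pow (ContinuousOn.inv₀ (by fun_prop) ?_) _
    exact fun p hp => (hdpos p hp).ne'
  have hint : IntegrableOn (fun p : V => g ‖p‖) (Metric.closedBall 0 P) :=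
    hcont.integrableOn_compact (isCompact_closedBall 0 P)
  have hm0 : MeasurableSet (Metric.closedBall (0 : V) P) := Metric.isClosed_closedBall.measurableSet
  rw [← ofReal_integral_eq_lintegral_ofReal hint (by
    filter_upwards [ae_restrict_mem hm0] with p hp
    have := hdpos p hp
    simp only [g, Pi.zero_apply]
    positivity)]
  congr 1
  have e1 : ∫ p in Metric.closedBall (0 : V) P, g ‖p‖ = ∫ p : V, (Iic P).indicator g ‖p‖ := by
    rw [← integral_indicator hm0]
    refine integral_congr_ae (Eventually.of_forall fun p => ?_)
    simp [indicator]
  have e2 : volume.real (Metric.ball (0 : V) 1) = √Real.pi ^ n / Real.Gamma (n / 2 + 1) := by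
    have : 0 < Real.Gamma ((n : ℝ) / 2 + 1) := Real.Gamma_pos_of_pos (by positivity)
    rw [Measure.real, InnerProductSpace.volume_ball, hn]
    simp
    positivity
  rw [e1, integral_fun_norm_addHaar, hn, e2, capVol_eq n hm hQ, ← hP, sphereArea, nsmul_eq_mul,
    smul_eq_mul, mul_assoc, intervalIntegral.integral_of_le (chartRadius_nonneg _ _)]
  congr 2
  rw [← integral_indicator measurableSet_Ioi, ← integral_indicator measurableSet_Ioc]
  refine integral_congr_ae (Eventually.of_forall fun t => ?_)
  by_cases h1 : 0 < t <;> by_cases h2 : t ≤ P <;>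
    simp [indicator, h1, h2, g, ← hP]

/-! ### From the space of hyperplanes to the signed distance -/

variable {d : ℕ} {lam : ℝ}

/-- The factor `cosh s - lam sinh s` by which orthogonal sections are scaled. -/
def scale (lam s : ℝ) : ℝ := Real.cosh s - lam * Real.sinh s

/-- The height of `H(s, u) ∩ B_R` over `geo s u`. -/
def capHeight (lam R s : ℝ) : ℝ := (Real.cosh R - Real.cosh s) / scale lam s

lemma scale_pos (h0 : 0 ≤ lam) (h1 : lam ≤ 1) (s : ℝ) : 0 < scale lam s := polar_snd_coeff_pos h0 h1

lemma continuous_scale : Continuous (scale lam) := by unfold scale; fun_prop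

lemma capHeight_nonneg (h0 : 0 ≤ lam) (h1 : lam ≤ 1) {R s : ℝ} (hs : |s| ≤ R) :
    0 ≤ capHeight lam R s := by
  have hcs : Real.cosh s ≤ Real.cosh R := by
    rw [Real.cosh_le_cosh, abs_of_nonneg ((abs_nonneg s).trans hs)]; exact hs
  exact div_nonneg (by linarith) (scale_pos h0 h1 s).le

lemma measurable_capHeight (R : ℝ) : Measurable (capHeight lam R) := by
  unfold capHeight
  exact (by fun_prop : Measurable fun s => Real.cosh R - Real.cosh s).div continuous_scale.measurable

lemma hausdorff_hyperplane_inter (hd : 2 ≤ d) (h0 : 0 ≤ lam) (h1 : lam ≤ 1)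
    (u : Metric.sphere (0 : EuclideanSpace ℝ (Fin d)) 1) {R s : ℝ} (hs : |s| ≤ R) :
    μHE[d - 1] (hyperplane lam s u ∩ Metric.closedBall origin R) =
      ENNReal.ofReal (sphereArea (d - 1) * capVol (d - 1) (1 - lam ^ 2) (capHeight lam R s)) := by
  rw [euclideanHausdorffMeasure_hyperplane_inter s (by omega) h0 h1 hs]
  exact lintegral_closedBall_conformal (finrank_tanSpace (by omega)) (by omega) (by nlinarith)
    (capHeight_nonneg h0 h1 hs)

lemma sphereProb_univ (hd : 1 ≤ d) : sphereProb d univ = 1 := by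
  have : Nonempty (Fin d) := ⟨⟨0, hd⟩⟩
  have : Nontrivial (EuclideanSpace ℝ (Fin d)) := inferInstance
  rw [sphereProb, Measure.smul_apply, smul_eq_mul]
  refine ENNReal.inv_mul_cancel ?_ (measure_ne_top _ _)
  rw [Ne, Measure.measure_univ_eq_zero]
  exact Measure.toSphere_ne_zero _

/-- The integrand of `I_{lam,k}(R)` as a function of the distance `s`. -/
def cumulantIntegrand (d : ℕ) (lam : ℝ) (k : ℕ) (R s : ℝ) : ℝ :=
  (sphereArea (d - 1) * capVol (d - 1) (1 - lam ^ 2) (capHeight lam R s)) ^ k *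
    scale lam s ^ (d - 1)

lemma measurable_cumulantIntegrand (k : ℕ) (R : ℝ) :
    Measurable (cumulantIntegrand d lam k R) := by
  unfold cumulantIntegrand
  exact ((((measurable_capVol _ _).comp (measurable_capHeight R)).const_mul _).pow_const _).mul
    (continuous_scale.measurable.pow_const _)

lemma cumulantIntegrand_nonneg (h0 : 0 ≤ lam) (h1 : lam ≤ 1) (hd : 2 ≤ d) (k : ℕ) (R s : ℝ) :
    0 ≤ cumulantIntegrand d lam k R s := by
  have := scale_pos h0 h1 s
  have := capVol_nonneg (d - 1) (1 - lam ^ 2) (capHeight lam R s)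
  have := sphereArea_pos (n := d - 1) (by omega)
  unfold cumulantIntegrand
  positivity

/-- The volume of `H(s, u) ∩ B_R` does not depend on `u`, so the normalized sphere factor integrates
to `1`. The condition `k ≠ 0` makes empty sections, those with `|s| > R`, contribute `0` rather than
`0 ^ 0 = 1`. -/
theorem cumulantIntegral_eq (hd : 2 ≤ d) (lam : unitInterval) {k : ℕ} (hk : k ≠ 0) (R : ℝ) :
    cumulantIntegral d lam k R =
      ∫⁻ s in Icc (-R) R, ENNReal.ofReal (cumulantIntegrand d lam k R s) := by
  have h0 : 0 ≤ (lam : ℝ) := lam.2.1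
  have h1 : (lam : ℝ) ≤ 1 := lam.2.2
  let w : ℝ → ℝ≥0∞ := fun s => ENNReal.ofReal (scale lam s ^ (d - 1))
  let v : ℝ → ℝ≥0∞ := (Icc (-R) R).indicator fun s => ENNReal.ofReal
    (sphereArea (d - 1) * capVol (d - 1) (1 - (lam : ℝ) ^ 2) (capHeight lam R s)) ^ k
  have hw : Measurable w := ((continuous_scale.pow _).measurable).ennreal_ofReal
  have hv : Measurable v :=
    ((((measurable_capVol _ _).comp (measurable_capHeight R)).const_mul _).ennreal_ofReal.pow_const
      _).indicator measurableSet_Icc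
  let f : Hyp d lam → ℝ≥0∞ := fun H =>
    (μHE[d - 1] (H.1 ∩ Metric.closedBall (origin : HypSpace d) R)) ^ k
  have hf : f ∘ param d lam = v ∘ Prod.fst := by
    funext q
    simp only [f, param, Function.comp_apply, v, indicator, mem_Icc, ← abs_le]
    split_ifs with hs
    · rw [hausdorff_hyperplane_inter hd h0 h1 q.2 hs]
    · rw [hyperplane_inter_closedBall_eq_empty q.1 h0 h1 (not_le.1 hs), measure_empty,
        zero_pow hk]
  -- The σ-algebra on hyperplanes is the one coinduced by the parametrization, so only `f ∘ param`
  -- has to be measurable.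
  have hfm : Measurable f := by
    intro t ht
    change MeasurableSet (param d lam ⁻¹' (f ⁻¹' t))
    rw [← preimage_comp, hf]
    exact (hv.comp measurable_fst) ht
  have hwm : Measurable fun q : ℝ × Metric.sphere (0 : EuclideanSpace ℝ (Fin d)) 1 => w q.1 :=
    hw.comp measurable_fst
  have hvm : Measurable fun q : ℝ × Metric.sphere (0 : EuclideanSpace ℝ (Fin d)) 1 => v q.1 :=
    hv.comp measurable_fst
  have : IsProbabilityMeasure (sphereProb d) := ⟨sphereProb_univ (by omega)⟩
  have step : cumulantIntegral d lam k R = ∫⁻ q, w q.1 * v q.1 ∂(volume.prod (sphereProb d)) := by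
    have e1 : cumulantIntegral d lam k R = ∫⁻ q, (f ∘ param d lam) q
        ∂((volume.prod (sphereProb d)).withDensity fun q => w q.1) :=
      lintegral_map hfm (measurable_param d lam)
    rw [e1, hf]
    exact lintegral_withDensity_eq_lintegral_mul _ hwm hvm
  have step2 : ∫⁻ q, w q.1 * v q.1 ∂(volume.prod (sphereProb d)) =
      ∫⁻ s, ∫⁻ _, w s * v s ∂(sphereProb d) := lintegral_prod _ (hwm.mul hvm).aemeasurable
  rw [step, step2]
  simp only [lintegral_const, measure_univ, mul_one]
  rw [← lintegral_indicator measurableSet_Icc]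
  refine lintegral_congr fun s => ?_
  simp only [v, indicator, w, cumulantIntegrand]
  split_ifs
  · have := capVol_nonneg (d - 1) (1 - (lam : ℝ) ^ 2) (capHeight lam R s)
    have h2 := sphereArea_pos (n := d - 1) (by omega)
    rw [← ENNReal.ofReal_pow (by positivity), mul_comm, ← ENNReal.ofReal_mul (by positivity)]
  · simp

theorem toReal_cumulantIntegral (hd : 2 ≤ d) (lam : unitInterval) {k : ℕ} (hk : k ≠ 0) (R : ℝ) :
    (cumulantIntegral d lam k R).toReal = ∫ s in Icc (-R) R, cumulantIntegrand d lam k R s := by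
  rw [cumulantIntegral_eq hd lam hk, integral_eq_lintegral_of_nonneg_ae]
  · exact Eventually.of_forall fun s => cumulantIntegrand_nonneg lam.2.1 lam.2.2 hd k R s
  · exact (measurable_cumulantIntegrand k R).aestronglyMeasurable

end

section

/-! ### Estimates for the radial volume -/

variable {m Q : ℝ} {n : ℕ}

lemma capVol_zero_curvature (hn : 1 ≤ n) (hQ : 0 ≤ Q) : capVol n 0 Q = √(2 * Q) ^ n / n := by
  rw [capVol_eq n le_rfl hQ]
  have : (n : ℝ) ≠ 0 := by positivity
  simp only [zero_div, zero_mul, sub_zero, inv_one, one_pow, mul_one, integral_pow, chartRadius,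
    add_zero, div_one]
  rw [Nat.sub_add_cancel hn]
  simp [Nat.cast_sub hn, show n ≠ 0 by omega]

/-- The height of a point at distance `t` from the centre of the conformal ball model. -/
def radialHeight (m t : ℝ) : ℝ := t ^ 2 / (2 * (1 - m / 4 * t ^ 2))

lemma hasDerivAt_radialHeight {t : ℝ} (ht : 1 - m / 4 * t ^ 2 ≠ 0) :
    HasDerivAt (radialHeight m) (t * (1 - m / 4 * t ^ 2)⁻¹ ^ 2) t := by
  have h1 : HasDerivAt (fun t : ℝ => t ^ 2) (2 * t) t := by
    simpa using hasDerivAt_pow 2 t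
  have h2 : HasDerivAt (fun t : ℝ => 2 * (1 - m / 4 * t ^ 2)) (2 * (-(m / 4 * (2 * t)))) t :=
    ((h1.const_mul (m / 4)).const_sub 1).const_mul 2
  refine (h1.div h2 (by simpa using ht)).congr_deriv ?_
  field_simp
  ring

lemma radialHeight_chartRadius (hm : 0 ≤ m) (hQ : 0 ≤ Q) :
    radialHeight m (chartRadius m Q) = Q := by
  have : 0 < 1 + m * Q / 2 := by positivity
  rw [radialHeight, chartRadius_denom hm hQ, chartRadius_sq hm hQ]
  field_simp

lemma radialHeight_zero : radialHeight m 0 = 0 := by simp [radialHeight]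

/-- With `τ = 1 - m/4 * t²` and height `h`, `(t / τ)² = 2h + m h² = m (h + 1/m)² - 1/m`, which lies
between `m h²` and `m (h + 1/m)²`. -/
lemma radial_integrand_bounds {t : ℝ} (hm : 0 < m) (ht : 0 ≤ t) (hτ : 0 < 1 - m / 4 * t ^ 2) :
    √m * radialHeight m t ≤ t * (1 - m / 4 * t ^ 2)⁻¹ ∧
      t * (1 - m / 4 * t ^ 2)⁻¹ ≤ √m * (radialHeight m t + 1 / m) := by
  set κ := √m with hκ
  have hκ0 : 0 < κ := Real.sqrt_pos.2 hm
  have hκm : m = κ ^ 2 := (Real.sq_sqrt hm.le).symm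
  simp only [radialHeight]
  constructor
  · have h2 : κ * t ≤ 2 := by
      refine le_of_sq_le_sq ?_ (by norm_num)
      rw [hκm] at hτ; nlinarith
    rw [← div_eq_mul_inv, ← mul_div_assoc, div_le_div_iff₀ (by positivity) hτ]
    have : 0 ≤ t * (1 - m / 4 * t ^ 2) := by positivity
    nlinarith
  · have : √m * (t ^ 2 / (2 * (1 - m / 4 * t ^ 2)) + 1 / m) =
        (κ ^ 2 * t ^ 2 / 4 + 1) / (κ * (1 - m / 4 * t ^ 2)) := by
      rw [← hκ]
      have e : 1 - m / 4 * t ^ 2 = 1 - κ ^ 2 / 4 * t ^ 2 := by rw [hκm]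
      have hne : 1 - κ ^ 2 / 4 * t ^ 2 ≠ 0 := by rw [← e]; exact hτ.ne'
      rw [e, hκm]
      have h4 : (4 - κ ^ 2 * t ^ 2) ≠ 0 := by
        intro h; apply hne; linarith
      field_simp
      ring
    rw [← hκ] at this
    rw [this, ← div_eq_mul_inv, div_le_div_iff₀ hτ (by positivity)]
    have h1 : κ * t ≤ κ ^ 2 * t ^ 2 / 4 + 1 := by nlinarith [sq_nonneg (κ * t - 2)]
    nlinarith

/-- Two-sided bounds for the volume, sharp for large `Q`, and an equality for `n = 2`. -/
lemma capVol_bounds (hn : 2 ≤ n) (hm : 0 < m) (hQ : 0 ≤ Q) :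
    √m ^ (n - 2) * (Q ^ (n - 1) / (n - 1)) ≤ capVol n m Q ∧
      capVol n m Q ≤
        √m ^ (n - 2) * (((Q + 1 / m) ^ (n - 1) - (1 / m) ^ (n - 1)) / (n - 1)) := by
  obtain ⟨j, rfl⟩ : ∃ j, n = j + 2 := ⟨n - 2, by omega⟩
  have hP := chartRadius_nonneg m Q
  have hτ : ∀ t ∈ Icc 0 (chartRadius m Q), 0 < 1 - m / 4 * t ^ 2 := fun t ht =>
    denom_pos_of_le_chartRadius hm.le hQ ht.1 ht.2
  have hci := continuousOn_radial (j + 2) hm.le hQ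
  rw [← uIcc_of_le hP] at hci
  have hii := hci.intervalIntegrable (μ := volume)
  -- Integration in the height variable; `a = 0` serves the lower bound and `a = 1 / m` the upper
  -- one.
  have ftc : ∀ a : ℝ, ∫ t in (0)..(chartRadius m Q),
      √m ^ j * ((radialHeight m t + a) ^ j * (t * (1 - m / 4 * t ^ 2)⁻¹ ^ 2)) =
      √m ^ j * (((Q + a) ^ (j + 1) - a ^ (j + 1)) / (j + 1)) ∧
      IntervalIntegrable (fun t => √m ^ j * ((radialHeight m t + a) ^ j *
        (t * (1 - m / 4 * t ^ 2)⁻¹ ^ 2))) volume 0 (chartRadius m Q) := by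
    intro a
    have hcont : ContinuousOn (fun t => (radialHeight m t + a) ^ j *
        (t * (1 - m / 4 * t ^ 2)⁻¹ ^ 2)) (uIcc 0 (chartRadius m Q)) := by
      rw [uIcc_of_le hP]
      have h1 : ContinuousOn (radialHeight m) (Icc 0 (chartRadius m Q)) := fun t ht =>
        (hasDerivAt_radialHeight (hτ t ht).ne').continuousAt.continuousWithinAt
      have h2 : ContinuousOn (fun t : ℝ => (1 - m / 4 * t ^ 2)⁻¹) (Icc 0 (chartRadius m Q)) :=
        ContinuousOn.inv₀ (by fun_prop) fun t ht => (hτ t ht).ne'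
      fun_prop
    refine ⟨?_, (continuousOn_const.mul hcont).intervalIntegrable⟩
    have hd : ∀ t ∈ uIcc 0 (chartRadius m Q), HasDerivAt
        (fun t => (radialHeight m t + a) ^ (j + 1) / (j + 1)) ((radialHeight m t + a) ^ j *
        (t * (1 - m / 4 * t ^ 2)⁻¹ ^ 2)) t := by
      intro t ht
      rw [uIcc_of_le hP] at ht
      have := (((hasDerivAt_radialHeight (hτ t ht).ne').add_const a).pow (j + 1)).div_const
        ((j : ℝ) + 1)
      refine this.congr_deriv ?_
      have : (j : ℝ) + 1 ≠ 0 := by positivity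
      push_cast
      field_simp
    rw [intervalIntegral.integral_const_mul,
      intervalIntegral.integral_eq_sub_of_hasDerivAt hd hcont.intervalIntegrable,
      radialHeight_chartRadius hm.le hQ, radialHeight_zero]
    ring
  -- The last factor is the derivative of the height, so the volume element is `(t / τ)^(n-2) dh`,
  -- to which `radial_integrand_bounds` applies.
  have hform : ∀ t : ℝ, t ^ (j + 2 - 1) * (1 - m / 4 * t ^ 2)⁻¹ ^ (j + 2) =
      (t * (1 - m / 4 * t ^ 2)⁻¹) ^ j * (t * (1 - m / 4 * t ^ 2)⁻¹ ^ 2) := fun t => by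
    rw [show j + 2 - 1 = j + 1 by omega]; ring
  have hcast : ((j + 2 : ℕ) : ℝ) - 1 = j + 1 := by push_cast; ring
  rw [hcast, capVol_eq _ hm.le hQ, show j + 2 - 2 = j by omega, show j + 2 - 1 = j + 1 by omega]
  have hbase : ∀ t ∈ Icc 0 (chartRadius m Q), 0 ≤ t * (1 - m / 4 * t ^ 2)⁻¹ ^ 2 ∧
      0 ≤ radialHeight m t := fun t ht => by
    have h1 := hτ t ht
    have h2 := ht.1
    unfold radialHeight
    constructor <;> positivity
  constructor
  · have e := (ftc 0).1
    simp only [add_zero, ne_eq, Nat.add_eq_zero_iff, one_ne_zero, and_false, not_false_eq_true,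
      zero_pow, sub_zero] at e
    rw [← e]
    have hint := (ftc 0).2
    simp only [add_zero] at hint
    refine intervalIntegral.integral_mono_on hP hint hii fun t ht => ?_
    have hb := radial_integrand_bounds hm ht.1 (hτ t ht)
    have h3 := hbase t ht
    rw [show j + 1 = j + 2 - 1 by omega, hform, ← mul_assoc (√m ^ j), ← mul_pow]
    exact mul_le_mul_of_nonneg_right
      (pow_le_pow_left₀ (mul_nonneg (Real.sqrt_nonneg _) h3.2) hb.1 j) h3.1
  · rw [← (ftc (1 / m)).1]
    refine intervalIntegral.integral_mono_on hP hii (ftc (1 / m)).2 fun t ht => ?_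
    have hb := radial_integrand_bounds hm ht.1 (hτ t ht)
    have h3 := hbase t ht
    have h4 := hτ t ht
    have h5 := ht.1
    rw [show j + 1 = j + 2 - 1 by omega, hform, ← mul_assoc (√m ^ j), ← mul_pow]
    exact mul_le_mul_of_nonneg_right
      (pow_le_pow_left₀ (by positivity) hb.2 j) h3.1

lemma capVol_two (hm : 0 < m) (hQ : 0 ≤ Q) : capVol 2 m Q = Q := by
  have h := capVol_bounds (n := 2) le_rfl hm hQ
  norm_num at h
  exact le_antisymm h.2 h.1

lemma chartRadius_le_capVol_one (hm : 0 ≤ m) (hQ : 0 ≤ Q) :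
    chartRadius m Q ≤ capVol 1 m Q := by
  have hP := chartRadius_nonneg m Q
  have hci := continuousOn_radial 1 hm hQ
  rw [← uIcc_of_le hP] at hci
  rw [capVol_eq 1 hm hQ]
  calc chartRadius m Q = ∫ _ in (0)..(chartRadius m Q), (1 : ℝ) := by simp
    _ ≤ _ := by
      refine intervalIntegral.integral_mono_on hP (by simp) hci.intervalIntegrable fun t ht => ?_
      have := denom_pos_of_le_chartRadius hm hQ ht.1 ht.2
      simp only [tsub_self, pow_zero, pow_one, one_mul]
      refine (one_le_inv₀ this).2 ?_
      have : 0 ≤ m / 4 * t ^ 2 := by positivity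
      linarith

/-- Factor the denominator as `(1 - κt/2)(1 + κt/2)` with `κ = √m`. Dropping the second factor,
which is at least `1`, leaves a logarithmic integral. At the end point `P` the product is `1 / (1 +
mQ/2)` and the second factor is at most `2`, hence `1 - κP/2 ≥ 1 / (2 + mQ)`. -/
lemma capVol_one_le_log (hm : 0 < m) (hQ : 0 ≤ Q) :
    √m * capVol 1 m Q ≤ 2 * Real.log (2 + m * Q) := by
  set κ := √m with hκ
  have hκ0 : 0 < κ := Real.sqrt_pos.2 hm
  have hκm : m = κ ^ 2 := (Real.sq_sqrt hm.le).symm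
  have hP := chartRadius_nonneg m Q
  have hci := continuousOn_radial 1 hm.le hQ
  rw [← uIcc_of_le hP] at hci
  have hfac : ∀ t, 1 - m / 4 * t ^ 2 = (1 - κ * t / 2) * (1 + κ * t / 2) := fun t => by
    rw [hκm]; ring
  have hpos : ∀ t ∈ Icc 0 (chartRadius m Q), 0 < 1 - κ * t / 2 := fun t ht => by
    have h1 := denom_pos_of_le_chartRadius hm.le hQ ht.1 ht.2
    have h2 : 0 < 1 + κ * t / 2 := by have := ht.1; positivity
    rw [hfac] at h1
    exact (pos_iff_pos_of_mul_pos h1).2 h2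
  have hd : ∀ t ∈ uIcc 0 (chartRadius m Q), HasDerivAt
      (fun t => -(2 / κ) * Real.log (1 - κ * t / 2)) ((1 - κ * t / 2)⁻¹) t := by
    intro t ht
    rw [uIcc_of_le hP] at ht
    have h1 : HasDerivAt (fun t : ℝ => 1 - κ * t / 2) (-(κ * 1 / 2)) t :=
      (((hasDerivAt_id t).const_mul κ).div_const 2).const_sub 1
    have h3 := (hpos t ht).ne'
    refine ((h1.log h3).const_mul (-(2 / κ))).congr_deriv ?_
    rw [div_eq_mul_inv (-(κ * 1 / 2))]
    field_simp
  have hc2 : ContinuousOn (fun t : ℝ => (1 - κ * t / 2)⁻¹) (uIcc 0 (chartRadius m Q)) := by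
    rw [uIcc_of_le hP]
    exact ContinuousOn.inv₀ (by fun_prop) fun t ht => (hpos t ht).ne'
  have hle : capVol 1 m Q ≤ -(2 / κ) * Real.log (1 - κ * chartRadius m Q / 2) := by
    rw [capVol_eq 1 hm.le hQ]
    have := intervalIntegral.integral_eq_sub_of_hasDerivAt hd hc2.intervalIntegrable
    simp only [mul_zero, zero_div, sub_zero, Real.log_one] at this
    rw [← this]
    refine intervalIntegral.integral_mono_on hP hci.intervalIntegrable hc2.intervalIntegrable
      fun t ht => ?_
    have h1 := hpos t ht
    have h2 : 0 ≤ κ * t / 2 := by have := ht.1; positivity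
    simp only [tsub_self, pow_zero, pow_one, one_mul]
    rw [hfac]
    exact inv_anti₀ h1 (le_mul_of_one_le_right h1.le (by linarith))
  have hPm := hpos _ (right_mem_Icc.2 hP)
  have hk : 0 < 1 + m * Q / 2 := by positivity
  have hlog : -Real.log (1 - κ * chartRadius m Q / 2) ≤ Real.log (2 + m * Q) := by
    rw [← Real.log_inv]
    refine Real.log_le_log (by positivity) ?_
    have h1 := chartRadius_denom hm.le hQ
    rw [hfac] at h1
    have h2 : (2 + m * Q)⁻¹ ≤ 1 - κ * chartRadius m Q / 2 := by
      have e : (2 + m * Q)⁻¹ = (1 - κ * chartRadius m Q / 2) * (1 + κ * chartRadius m Q / 2) / 2 := by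
        rw [h1]; field_simp
      rw [e]; nlinarith
    exact inv_le_of_inv_le₀ (by positivity) h2
  calc κ * capVol 1 m Q ≤ κ * (-(2 / κ) * Real.log (1 - κ * chartRadius m Q / 2)) := by gcongr
    _ = 2 * -Real.log (1 - κ * chartRadius m Q / 2) := by field_simp
    _ ≤ _ := by gcongr

/-- Take `log x ≤ x^ε / ε` with `ε = 1 / (2k)`, so that the `k`-th power is exactly a square root.
-/
lemma log_pow_le {k : ℕ} (hk : 1 ≤ k) {x : ℝ} (hx : 1 ≤ x) :
    Real.log x ^ k ≤ (2 * k) ^ k * √x := by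
  have hk0 : (0 : ℝ) < k := by exact_mod_cast hk
  have h1 : Real.log x ≤ x ^ (1 / (2 * (k : ℝ))) / (1 / (2 * (k : ℝ))) :=
    Real.log_le_rpow_div (by linarith) (by positivity)
  have h2 : x ^ (1 / (2 * (k : ℝ))) / (1 / (2 * (k : ℝ))) = 2 * k * x ^ (1 / (2 * (k : ℝ))) := by
    field_simp
  rw [h2] at h1
  calc Real.log x ^ k ≤ (2 * k * x ^ (1 / (2 * (k : ℝ)))) ^ k :=
        pow_le_pow_left₀ (Real.log_nonneg hx) h1 k
    _ = (2 * k) ^ k * √x := by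
      rw [mul_pow, ← Real.rpow_mul_natCast (by linarith), Real.sqrt_eq_rpow]
      congr 2; field_simp

end

section

/-! ### Asymptotics for `lam < 1` and `d ≥ 3` -/

lemma isEquivalent_const_mul_of_tendsto {f g : ℝ → ℝ} {C : ℝ} (hC : C ≠ 0)
    (hg : ∀ᶠ R in atTop, g R ≠ 0) (h : Tendsto (fun R => f R / g R) atTop (𝓝 C)) :
    f ~[atTop] fun R => C * g R := by
  refine (isEquivalent_iff_tendsto_one ?_).2 ?_
  · filter_upwards [hg] with R hR using mul_ne_zero hC hR
  · have := h.div_const C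
    rw [div_self hC] at this
    refine this.congr fun R => ?_
    rw [Pi.div_apply, div_div, mul_comm]

lemma one_add_sq_le_two_mul_cosh (s : ℝ) : 1 + s ^ 2 ≤ 2 * Real.cosh s := by
  have h : Real.cosh |s| = 1 + 2 * Real.sinh (|s| / 2) ^ 2 := by
    have := Real.cosh_two_mul (|s| / 2)
    rw [mul_div_cancel₀ _ two_ne_zero, Real.cosh_sq] at this
    linarith
  have h2 : |s| / 2 ≤ Real.sinh (|s| / 2) := Real.self_le_sinh_iff.2 (by positivity)
  have h3 : (|s| / 2) ^ 2 ≤ Real.sinh (|s| / 2) ^ 2 := by gcongr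
  rw [Real.cosh_abs] at h
  rw [div_pow, sq_abs] at h3
  linarith

lemma integrable_inv_cosh_pow {M : ℕ} (hM : 1 ≤ M) :
    Integrable fun s : ℝ => (Real.cosh s)⁻¹ ^ M := by
  refine (integrable_inv_one_add_sq.const_mul 2).mono' ?_ (Eventually.of_forall fun s => ?_)
  · exact ((Real.continuous_cosh.inv₀ fun s => (Real.cosh_pos s).ne').pow M).aestronglyMeasurable
  · have hc := Real.cosh_pos s
    rw [Real.norm_of_nonneg (by positivity)]
    calc (Real.cosh s)⁻¹ ^ M ≤ (Real.cosh s)⁻¹ ^ 1 :=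
          pow_le_pow_of_le_one (by positivity) (inv_le_one_of_one_le₀ (Real.one_le_cosh s)) hM
      _ ≤ 2 * (1 + s ^ 2)⁻¹ := by
        rw [pow_one, ← div_eq_mul_inv, inv_eq_one_div, div_le_div_iff₀ hc (by positivity)]
        linarith [one_add_sq_le_two_mul_cosh s]

lemma integral_inv_cosh_pow_pos {M : ℕ} (hM : 1 ≤ M) :
    0 < ∫ s : ℝ, (Real.cosh s)⁻¹ ^ M := by
  have hp : ∀ s : ℝ, 0 < (Real.cosh s)⁻¹ ^ M := fun s => by
    have := Real.cosh_pos s; positivity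
  rw [integral_pos_iff_support_of_nonneg (fun s => (hp s).le) (integrable_inv_cosh_pow hM)]
  have : Function.support (fun s : ℝ => (Real.cosh s)⁻¹ ^ M) = univ :=
    eq_univ_of_forall fun s => (hp s).ne'
  rw [this]
  simp

variable {lam : ℝ}

/-- The addition formula with `lam = tanh a`. By translation invariance, integrals of powers of the
scale become integrals of powers of `cosh` times a power of `√(1 - lam ^ 2)`, which isolates the
dependence on `lam`. -/
lemma scale_eq_mul_cosh (h0 : 0 ≤ lam) (h1 : lam < 1) (s : ℝ) :
    scale lam s = √(1 - lam ^ 2) * Real.cosh (s - Real.artanh lam) := by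
  have hm : 0 < √(1 - lam ^ 2) := Real.sqrt_pos.2 (by nlinarith)
  have hl : lam ∈ Ioo (-1) 1 := ⟨by linarith, h1⟩
  rw [Real.cosh_sub, Real.cosh_artanh hl, Real.sinh_artanh hl, scale]
  field_simp

lemma scale_le_exp_abs (h0 : 0 ≤ lam) (h1 : lam ≤ 1) (s : ℝ) : scale lam s ≤ Real.exp |s| := by
  have h2 : -(lam * Real.sinh s) ≤ Real.sinh |s| := by
    have h3 : |lam * Real.sinh s| ≤ Real.sinh |s| := by
      rw [abs_mul, Real.abs_sinh, abs_of_nonneg h0]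
      exact mul_le_of_le_one_left (Real.sinh_nonneg_iff.2 (abs_nonneg s)) h1
    exact (neg_le_abs _).trans h3
  rw [← Real.cosh_add_sinh, Real.cosh_abs, scale]
  linarith

lemma cosh_le_exp {R : ℝ} (hR : 0 ≤ R) : Real.cosh R ≤ Real.exp R := by
  have := Real.sinh_nonneg_iff.2 hR
  rw [← Real.cosh_add_sinh]; linarith

lemma tendsto_cosh_mul_exp_neg :
    Tendsto (fun R => Real.cosh R * Real.exp (-R)) atTop (𝓝 (1 / 2)) := by
  have h : ∀ R : ℝ, Real.cosh R * Real.exp (-R) = (1 + Real.exp (-R) * Real.exp (-R)) / 2 := by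
    intro R
    rw [Real.cosh_eq, div_mul_eq_mul_div, add_mul, ← Real.exp_add R, add_neg_cancel, Real.exp_zero]
  simp only [h]
  have := Real.tendsto_exp_neg_atTop_nhds_zero
  simpa using ((this.mul this).const_add 1).div_const 2

lemma tendsto_capHeight_mul_exp_neg (s : ℝ) :
    Tendsto (fun R => capHeight lam R s * Real.exp (-R)) atTop (𝓝 (1 / 2 / scale lam s)) := by
  have h2 := (tendsto_cosh_mul_exp_neg.sub
    (Real.tendsto_exp_neg_atTop_nhds_zero.const_mul (Real.cosh s))).div_const (scale lam s)
  simp only [mul_zero, sub_zero] at h2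
  refine h2.congr fun R => ?_
  simp only [capHeight]; ring

/-- The two bounds for the cap volume differ by a shift of the height by `1 / (1 - lam ^ 2)`, which
vanishes after multiplication by `e^{-R}`. -/
lemma tendsto_capVol_mul_exp_neg {n : ℕ} (hn : 2 ≤ n) (h0 : 0 ≤ lam) (h1 : lam < 1) (s : ℝ) :
    Tendsto (fun R => capVol n (1 - lam ^ 2) (capHeight lam R s) * Real.exp (-R) ^ (n - 1)) atTop
      (𝓝 (√(1 - lam ^ 2) ^ (n - 2) * ((1 / 2 / scale lam s) ^ (n - 1) / (n - 1)))) := by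
  have hm : 0 < 1 - lam ^ 2 := by nlinarith
  have hn1 : (0 : ℝ) < n - 1 := by
    have : (2 : ℝ) ≤ n := by exact_mod_cast hn
    linarith
  have l1 := tendsto_capHeight_mul_exp_neg (lam := lam) s
  have l2 := l1.add (Real.tendsto_exp_neg_atTop_nhds_zero.const_mul (1 / (1 - lam ^ 2)))
  simp only [mul_zero, add_zero] at l2
  have e : ∀ᶠ R in atTop, |s| ≤ R := eventually_ge_atTop _
  refine tendsto_of_tendsto_of_tendsto_of_le_of_le'
    (((l1.pow (n - 1)).div_const ((n : ℝ) - 1)).const_mul (√(1 - lam ^ 2) ^ (n - 2)))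
    (((l2.pow (n - 1)).div_const ((n : ℝ) - 1)).const_mul (√(1 - lam ^ 2) ^ (n - 2))) ?_ ?_
  · filter_upwards [e] with R hR
    have hb := (capVol_bounds hn hm (capHeight_nonneg h0 h1.le hR)).1
    calc _ = √(1 - lam ^ 2) ^ (n - 2) * (capHeight lam R s ^ (n - 1) / (n - 1)) *
          Real.exp (-R) ^ (n - 1) := by ring
      _ ≤ _ := by gcongr
  · filter_upwards [e] with R hR
    have hQ := capHeight_nonneg h0 h1.le hR
    have hb := (capVol_bounds hn hm hQ).2
    calc _ ≤ √(1 - lam ^ 2) ^ (n - 2) * ((capHeight lam R s + 1 / (1 - lam ^ 2)) ^ (n - 1) /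
          (n - 1)) * Real.exp (-R) ^ (n - 1) := by
          gcongr
          refine hb.trans ?_
          gcongr
          have : 0 ≤ (1 / (1 - lam ^ 2)) ^ (n - 1) := by positivity
          linarith
      _ = √(1 - lam ^ 2) ^ (n - 2) * (((capHeight lam R s + 1 / (1 - lam ^ 2)) *
          Real.exp (-R)) ^ (n - 1) / (n - 1)) := by rw [mul_pow]; ring
      _ = _ := by rw [add_mul]

/-- This supplies the dominating function. For `|s| ≤ R` the scale is at most `e^R`, so the constant
shift of the height can be absorbed into a multiple of `e^R / scale lam s`. -/
lemma capVol_mul_exp_neg_le {n : ℕ} (hn : 2 ≤ n) (h0 : 0 ≤ lam) (h1 : lam < 1) {R s : ℝ}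
    (hs : |s| ≤ R) :
    capVol n (1 - lam ^ 2) (capHeight lam R s) * Real.exp (-R) ^ (n - 1) ≤
      √(1 - lam ^ 2) ^ (n - 2) * ((1 + 1 / (1 - lam ^ 2)) ^ (n - 1) / (n - 1)) *
        (scale lam s)⁻¹ ^ (n - 1) := by
  have hm : 0 < 1 - lam ^ 2 := by nlinarith
  have hn1 : (0 : ℝ) < n - 1 := by
    have : (2 : ℝ) ≤ n := by exact_mod_cast hn
    linarith
  have hQ := capHeight_nonneg h0 h1.le hs
  have hb := (capVol_bounds hn hm hQ).2
  have hc := scale_pos h0 h1.le s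
  have hce : scale lam s ≤ Real.exp R :=
    (scale_le_exp_abs h0 h1.le s).trans (Real.exp_le_exp.2 hs)
  have hR : 0 ≤ R := (abs_nonneg s).trans hs
  have hQe : (capHeight lam R s + 1 / (1 - lam ^ 2)) * Real.exp (-R) ≤
      (1 + 1 / (1 - lam ^ 2)) * (scale lam s)⁻¹ := by
    have e1 : capHeight lam R s ≤ Real.exp R * (scale lam s)⁻¹ := by
      rw [capHeight, div_eq_mul_inv]
      gcongr
      linarith [cosh_le_exp hR, Real.cosh_pos s]
    have e2 : 1 ≤ Real.exp R * (scale lam s)⁻¹ := by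
      rw [← div_eq_mul_inv, one_le_div hc]; exact hce
    have e3 : 1 / (1 - lam ^ 2) ≤ 1 / (1 - lam ^ 2) * (Real.exp R * (scale lam s)⁻¹) :=
      le_mul_of_one_le_right (by positivity) e2
    calc _ ≤ (Real.exp R * (scale lam s)⁻¹ + 1 / (1 - lam ^ 2) *
          (Real.exp R * (scale lam s)⁻¹)) * Real.exp (-R) := by gcongr
      _ = (1 + 1 / (1 - lam ^ 2)) * (scale lam s)⁻¹ * (Real.exp R * Real.exp (-R)) := by ring
      _ = _ := by rw [← Real.exp_add]; simp
  calc _ ≤ √(1 - lam ^ 2) ^ (n - 2) * ((capHeight lam R s + 1 / (1 - lam ^ 2)) ^ (n - 1) /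
          (n - 1)) * Real.exp (-R) ^ (n - 1) := by
        gcongr
        refine hb.trans ?_
        gcongr
        have : 0 ≤ (1 / (1 - lam ^ 2)) ^ (n - 1) := by positivity
        linarith
    _ = √(1 - lam ^ 2) ^ (n - 2) / (n - 1) *
          ((capHeight lam R s + 1 / (1 - lam ^ 2)) * Real.exp (-R)) ^ (n - 1) := by
        rw [mul_pow]; ring
    _ ≤ √(1 - lam ^ 2) ^ (n - 2) / (n - 1) *
          ((1 + 1 / (1 - lam ^ 2)) * (scale lam s)⁻¹) ^ (n - 1) := by gcongr
    _ = _ := by rw [mul_pow]; ring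

lemma scale_pow_cancel {k n : ℕ} (h : n ≤ k * (n - 1)) {c : ℝ} (hc : 0 < c) (a : ℝ) :
    (a * c⁻¹ ^ (n - 1)) ^ k * c ^ n = a ^ k * c⁻¹ ^ (k * (n - 1) - n) := by
  obtain ⟨M, hM⟩ := Nat.exists_eq_add_of_le h
  rw [mul_pow, ← pow_mul, mul_comm (n - 1) k, hM, Nat.add_sub_cancel_left, pow_add]
  rw [mul_assoc, mul_comm (c⁻¹ ^ n), mul_assoc, ← mul_pow, inv_mul_cancel₀ hc.ne', one_pow, mul_one]

/-- The constant in the asymptotics of `I_{lam,k}(R)` for `lam < 1`. -/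
def cumulantConst (k d : ℕ) : ℝ :=
  (sphereArea (d - 1) * ((1 / 2) ^ (d - 2) / ((d : ℝ) - 2))) ^ k *
    ∫ s : ℝ, (Real.cosh s)⁻¹ ^ (k * (d - 2) - (d - 1))

lemma cumulantConst_pos {k d : ℕ} (hd : 3 ≤ d) (hk : d - 1 < k * (d - 2)) :
    0 < cumulantConst k d := by
  have h1 := sphereArea_pos (n := d - 1) (by omega)
  have h2 : (0 : ℝ) < d - 2 := by
    have : (3 : ℝ) ≤ d := by exact_mod_cast hd
    linarith
  have h3 := integral_inv_cosh_pow_pos (M := k * (d - 2) - (d - 1)) (by omega)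
  unfold cumulantConst
  positivity

/-- Dominated convergence after division by `e^{k(d-2)R}`. The hypothesis `hkd` says that the
limiting integrand carries a strictly negative power of the scale, hence decays exponentially in
`|s|`. -/
theorem isEquivalent_cumulantIntegral {d k : ℕ} (hd : 3 ≤ d) (hkd : d - 1 < k * (d - 2))
    (lam : unitInterval) (hlam : (lam : ℝ) < 1) :
    (fun R : ℝ => (cumulantIntegral d lam k R).toReal) ~[atTop]
      fun R : ℝ => cumulantConst k d * (1 - (lam : ℝ) ^ 2) ^ (((d : ℝ) - 1 - k) / 2) *
        Real.exp (k * ((d : ℝ) - 2) * R) := by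
  obtain ⟨n, rfl⟩ : ∃ n, d = n + 1 := ⟨d - 1, by omega⟩
  have hk0 : k ≠ 0 := by rintro rfl; omega
  have hn : 2 ≤ n := by omega
  have hn1 : n + 1 - 2 = n - 1 := by omega
  simp only [Nat.add_sub_cancel, hn1] at hkd
  have h0 : 0 ≤ (lam : ℝ) := lam.2.1
  have hm : 0 < 1 - (lam : ℝ) ^ 2 := by nlinarith
  set m := 1 - (lam : ℝ) ^ 2 with hmdef
  set κ := √m with hκ
  have hκ0 : 0 < κ := Real.sqrt_pos.2 hm
  have hcpos := scale_pos h0 hlam.le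
  set M := k * (n - 1) - n with hMdef
  have hn1R : (0 : ℝ) < n - 1 := by
    have : (2 : ℝ) ≤ n := by exact_mod_cast hn
    linarith
  have hω := sphereArea_pos (n := n) (by omega)
  have hintc : Integrable fun s => (scale (lam : ℝ) s)⁻¹ ^ M := by
    have := ((integrable_inv_cosh_pow (M := M) (by omega)).comp_sub_right
      (Real.artanh lam)).const_mul (κ⁻¹ ^ M)
    refine this.congr (Eventually.of_forall fun s => ?_)
    simp only [scale_eq_mul_cosh h0 hlam]
    rw [mul_inv, mul_pow]
  have hintval : ∫ s, (scale (lam : ℝ) s)⁻¹ ^ M = κ⁻¹ ^ M * ∫ s : ℝ, (Real.cosh s)⁻¹ ^ M := by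
    rw [← integral_sub_right_eq_self (fun s : ℝ => (Real.cosh s)⁻¹ ^ M) (Real.artanh lam),
      ← integral_const_mul]
    refine integral_congr_ae (Eventually.of_forall fun s => ?_)
    simp only [scale_eq_mul_cosh h0 hlam]
    rw [mul_inv, mul_pow]
  let g : ℝ → ℝ := fun R => Real.exp (k * ((n : ℝ) - 1) * R)
  have hg : ∀ R, (g R)⁻¹ = (Real.exp (-R) ^ (n - 1)) ^ k := by
    intro R
    simp only [g]
    rw [← Real.exp_nat_mul, ← Real.exp_nat_mul, ← Real.exp_neg]
    congr 1
    rw [Nat.cast_sub (by omega)]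
    push_cast; ring
  let F : ℝ → ℝ → ℝ := fun R s => (Icc (-R) R).indicator (fun s =>
    (sphereArea n * (capVol n m (capHeight lam R s) * Real.exp (-R) ^ (n - 1))) ^ k *
      scale lam s ^ n) s
  have hFint : ∀ R, (cumulantIntegral (n + 1) lam k R).toReal / g R = ∫ s, F R s := by
    intro R
    rw [toReal_cumulantIntegral (by omega) lam hk0, div_eq_mul_inv, hg, mul_comm,
      ← integral_const_mul, ← integral_indicator measurableSet_Icc]
    refine integral_congr_ae (Eventually.of_forall fun s => ?_)
    simp only [F, indicator]
    split_ifs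
    · simp only [cumulantIntegrand, Nat.add_sub_cancel, ← hmdef]; ring
    · rfl
  let B : ℝ := sphereArea n * (κ ^ (n - 2) * ((1 + 1 / m) ^ (n - 1) / (n - 1)))
  have hlim : Tendsto (fun R => ∫ s, F R s) atTop
      (𝓝 (∫ s, (sphereArea n * (κ ^ (n - 2) * ((1 / 2) ^ (n - 1) / (n - 1)))) ^ k *
        (scale (lam : ℝ) s)⁻¹ ^ M)) := by
    refine tendsto_integral_filter_of_dominated_convergence
      (fun s => B ^ k * (scale (lam : ℝ) s)⁻¹ ^ M) ?_ ?_ (hintc.const_mul _) ?_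
    · refine Eventually.of_forall fun R => Measurable.aestronglyMeasurable ?_
      refine Measurable.indicator ?_ measurableSet_Icc
      exact (((((measurable_capVol _ _).comp (measurable_capHeight R)).mul_const _).const_mul
        _).pow_const _).mul (continuous_scale.measurable.pow_const _)
    · refine Eventually.of_forall fun R => Eventually.of_forall fun s => ?_
      have hc := hcpos s
      simp only [F, indicator, mem_Icc, ← abs_le]
      split_ifs with hs
      · have hv := capVol_nonneg n m (capHeight lam R s)
        rw [Real.norm_of_nonneg (by positivity), ← scale_pow_cancel (by omega) hc]
        refine mul_le_mul_of_nonneg_right (pow_le_pow_left₀ (by positivity) ?_ k) (by positivity)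
        simp only [B]
        rw [mul_assoc (sphereArea n)]
        exact mul_le_mul_of_nonneg_left (capVol_mul_exp_neg_le hn h0 hlam hs) hω.le
      · simp only [norm_zero]
        simp only [B]
        positivity
    · refine Eventually.of_forall fun s => ?_
      have hc := hcpos s
      have := (((tendsto_capVol_mul_exp_neg hn h0 hlam s).const_mul (sphereArea n)).pow k).mul_const
        (scale lam s ^ n)
      have e : (sphereArea n * (κ ^ (n - 2) * ((1 / 2 / scale lam s) ^ (n - 1) / (n - 1)))) ^ k *
          scale lam s ^ n = (sphereArea n * (κ ^ (n - 2) * ((1 / 2) ^ (n - 1) / (n - 1)))) ^ k *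
            (scale lam s)⁻¹ ^ M := by
        rw [← scale_pow_cancel (by omega) hc, div_pow, inv_pow]
        congr 2
        field_simp
      rw [e] at this
      refine this.congr' ?_
      filter_upwards [eventually_ge_atTop |s|] with R hR
      have hmem : s ∈ Icc (-R) R := abs_le.1 hR
      simp only [F]
      rw [indicator_of_mem hmem]
  have hval : ∫ s, (sphereArea n * (κ ^ (n - 2) * ((1 / 2) ^ (n - 1) / (n - 1)))) ^ k *
      (scale (lam : ℝ) s)⁻¹ ^ M = cumulantConst k (n + 1) * m ^ (((n : ℝ) - k) / 2) := by
    -- The cap volumes contribute `(n - 2) k` powers of `√m`, the integral of the scale `-M`; the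
    -- total is `n - k`.
    have hpow : κ ^ ((n - 2) * k) * κ⁻¹ ^ M = m ^ (((n : ℝ) - k) / 2) := by
      rw [hκ, Real.sqrt_eq_rpow, ← Real.rpow_neg hm.le, ← Real.rpow_mul_natCast hm.le,
        ← Real.rpow_mul_natCast hm.le, ← Real.rpow_add hm]
      congr 1
      rw [hMdef, Nat.cast_sub hkd.le]
      push_cast
      rw [Nat.cast_sub hn, Nat.cast_sub (by omega : 1 ≤ n)]
      push_cast
      ring
    have hcast : ((n + 1 : ℕ) : ℝ) - 2 = n - 1 := by push_cast; ring
    rw [integral_const_mul, hintval, cumulantConst, ← hpow, hcast, Nat.add_sub_cancel, hn1, pow_mul,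
      mul_pow, mul_pow, mul_pow]
    ring
  have hcd : ((n + 1 : ℕ) : ℝ) - 1 - k = n - k := by push_cast; ring
  have hcd2 : ((n + 1 : ℕ) : ℝ) - 2 = n - 1 := by push_cast; ring
  rw [hcd, hcd2]
  refine isEquivalent_const_mul_of_tendsto (g := g) ?_ ?_ ?_
  · have := cumulantConst_pos (k := k) (d := n + 1) hd (by simpa [hn1] using hkd)
    positivity
  · exact Eventually.of_forall fun R => (Real.exp_pos _).ne'
  · simp only [hFint]
    rw [← hval]
    exact hlim

end

section

/-! ### The critical case and horospheres -/

lemma integral_cosh_Icc {R : ℝ} (hR : 0 ≤ R) :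
    ∫ s in Icc (-R) R, Real.cosh s = 2 * Real.sinh R := by
  rw [integral_Icc_eq_integral_Ioc, ← intervalIntegral.integral_of_le (by linarith),
    intervalIntegral.integral_eq_sub_of_hasDerivAt (fun x _ => Real.hasDerivAt_sinh x)
      (Real.continuous_cosh.intervalIntegrable _ _), Real.sinh_neg]
  ring

/-- Except near the ends of `[-R, R]`, `cosh s` is negligible against `cosh R`. After factoring out
`cosh R ^ n`, the integral is at most `2R`, and Bernoulli's inequality shows that at most `2n` is
lost. -/
lemma tendsto_integral_cosh_sub_cosh_pow (n : ℕ) :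
    Tendsto (fun R => (∫ s in Icc (-R) R, (Real.cosh R - Real.cosh s) ^ n) /
      (R * Real.exp (n * R))) atTop (𝓝 (2 * (1 / 2) ^ n)) := by
  have hfac : ∀ R, (∫ s in Icc (-R) R, (Real.cosh R - Real.cosh s) ^ n) =
      Real.cosh R ^ n * ∫ s in Icc (-R) R, (1 - Real.cosh s / Real.cosh R) ^ n := by
    intro R
    rw [← integral_const_mul]
    refine integral_congr_ae (Eventually.of_forall fun s => ?_)
    have := Real.cosh_pos R
    simp only
    rw [← mul_pow]
    congr 1
    field_simp
  have hquot : ∀ R, (∫ s in Icc (-R) R, (Real.cosh R - Real.cosh s) ^ n) /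
      (R * Real.exp (n * R)) = (∫ s in Icc (-R) R, (1 - Real.cosh s / Real.cosh R) ^ n) / R *
        (Real.cosh R * Real.exp (-R)) ^ n := by
    intro R
    rw [hfac, Real.exp_nat_mul, Real.exp_neg, mul_pow, inv_pow]
    have := Real.exp_pos R
    field_simp
  simp only [hquot]
  refine Tendsto.mul ?_ (tendsto_cosh_mul_exp_neg.pow n)
  have hcont : ∀ R, Continuous fun s => (1 - Real.cosh s / Real.cosh R) ^ n := fun R => by fun_prop
  have hrange : ∀ R s, s ∈ Icc (-R) R → 0 ≤ Real.cosh s / Real.cosh R ∧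
      Real.cosh s / Real.cosh R ≤ 1 := by
    intro R s hs
    have h1 := Real.cosh_pos s
    have h2 := Real.cosh_pos R
    refine ⟨by positivity, (div_le_one h2).2 ?_⟩
    have hs' : |s| ≤ R := abs_le.2 hs
    rw [Real.cosh_le_cosh, abs_of_nonneg ((abs_nonneg s).trans hs')]
    exact hs'
  have hlow : Tendsto (fun R : ℝ => 2 - 2 * n / R) atTop (𝓝 2) := by
    simpa using (tendsto_const_nhds (x := (2 : ℝ))).sub
      (tendsto_const_nhds (x := (2 * n : ℝ)).div_atTop tendsto_id)
  refine tendsto_of_tendsto_of_tendsto_of_le_of_le' hlow tendsto_const_nhds ?_ ?_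
  · filter_upwards [eventually_gt_atTop 0] with R hR
    have hc := Real.cosh_pos R
    have hlin : ∫ s in Icc (-R) R, (1 - n * (Real.cosh s / Real.cosh R)) =
        2 * R - n * (2 * Real.sinh R / Real.cosh R) := by
      rw [integral_sub (by simp) ((by fun_prop : Continuous fun s =>
        (n : ℝ) * (Real.cosh s / Real.cosh R)).integrableOn_Icc), integral_const_mul,
        integral_div, integral_cosh_Icc hR.le]
      simp [hR.le]
      ring_nf
    have hle : 2 * R - n * (2 * Real.sinh R / Real.cosh R) ≤
        ∫ s in Icc (-R) R, (1 - Real.cosh s / Real.cosh R) ^ n := by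
      rw [← hlin]
      refine setIntegral_mono_on (by fun_prop : Continuous fun s =>
        1 - (n : ℝ) * (Real.cosh s / Real.cosh R)).integrableOn_Icc (hcont R).integrableOn_Icc
        measurableSet_Icc fun s hs => ?_
      have h := hrange R s hs
      have := one_add_mul_le_pow (a := -(Real.cosh s / Real.cosh R)) (by linarith) n
      calc _ = 1 + n * -(Real.cosh s / Real.cosh R) := by ring
        _ ≤ _ := this
        _ = _ := by ring
    have h3 : 2 * Real.sinh R / Real.cosh R ≤ 2 := by
      rw [div_le_iff₀ hc]; linarith [Real.sinh_lt_cosh R]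
    rw [le_div_iff₀ hR]
    have : (2 - 2 * n / R) * R = 2 * R - n * 2 := by field_simp
    rw [this]
    refine le_trans ?_ hle
    gcongr
  · filter_upwards [eventually_gt_atTop 0] with R hR
    rw [div_le_iff₀ hR]
    calc _ ≤ ∫ _ in Icc (-R) R, (1 : ℝ) := by
          refine setIntegral_mono_on (hcont R).integrableOn_Icc (by simp) measurableSet_Icc
            fun s hs => ?_
          have h := hrange R s hs
          exact pow_le_one₀ (by linarith) (by linarith)
      _ = 2 * R := by simp [hR.le]; ring

/-- The logarithmic regime, where the integrand is a multiple of `(cosh R - cosh s) ^ n`. -/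
lemma isEquivalent_of_integrand_eq {d k n : ℕ} (hd : 2 ≤ d) (hk : k ≠ 0) (lam : unitInterval)
    {C : ℝ} (hC : 0 < C) (h : ∀ R s, s ∈ Icc (-R) R →
      cumulantIntegrand d lam k R s = C * (Real.cosh R - Real.cosh s) ^ n) :
    (fun R : ℝ => (cumulantIntegral d lam k R).toReal) ~[atTop]
      fun R : ℝ => C * (2 * (1 / 2) ^ n) * (R * Real.exp (n * R)) := by
  refine isEquivalent_const_mul_of_tendsto (by positivity) ?_ ?_
  · filter_upwards [eventually_gt_atTop 0] with R hR
    positivity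
  · refine ((tendsto_integral_cosh_sub_cosh_pow n).const_mul C).congr fun R => ?_
    rw [toReal_cumulantIntegral hd lam hk, ← mul_div_assoc, ← integral_const_mul]
    congr 1
    exact setIntegral_congr_fun measurableSet_Icc fun s hs => (h R s hs).symm

/-- For two-dimensional sections the cap volume is exactly the height, so its square cancels the
density `scale ^ 2`. -/
lemma cumulantIntegrand_three_two {lam : unitInterval} (hlam : (lam : ℝ) < 1) (R s : ℝ)
    (hs : s ∈ Icc (-R) R) :
    cumulantIntegrand 3 lam 2 R s = sphereArea 2 ^ 2 * (Real.cosh R - Real.cosh s) ^ 2 := by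
  have h0 : 0 ≤ (lam : ℝ) := lam.2.1
  have hQ := capHeight_nonneg h0 hlam.le (abs_le.2 hs)
  have hc := scale_pos h0 hlam.le s
  rw [cumulantIntegrand, show 3 - 1 = 2 from rfl, capVol_two (by nlinarith) hQ, capHeight]
  field_simp

/-- For `lam = 1` the hyperplane is flat, its section is a Euclidean ball of radius `√(2Q)`, and the
scale is `e^{-s}`. -/
lemma cumulantIntegrand_horosphere {d : ℕ} (hd : 2 ≤ d) (k : ℕ) (R s : ℝ) (hs : s ∈ Icc (-R) R) :
    cumulantIntegrand d 1 k R s = (sphereArea (d - 1) / (d - 1 : ℕ)) ^ k *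
      (√(2 * (Real.cosh R - Real.cosh s) * Real.exp s) ^ ((d - 1) * k) *
        Real.exp (-s) ^ (d - 1)) := by
  have hsc : scale 1 s = Real.exp (-s) := by
    rw [scale, one_mul, Real.cosh_sub_sinh]
  have hQ := capHeight_nonneg zero_le_one le_rfl (abs_le.2 hs)
  have h2 : 2 * capHeight 1 R s = 2 * (Real.cosh R - Real.cosh s) * Real.exp s := by
    rw [capHeight, hsc, Real.exp_neg, div_inv_eq_mul]; ring
  rw [cumulantIntegrand, one_pow, sub_self, capVol_zero_curvature (by omega) hQ, h2, hsc,
    mul_div_assoc', mul_div_right_comm, mul_pow, ← pow_mul]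
  ring

lemma cumulantIntegrand_horosphere_two {d : ℕ} (hd : 2 ≤ d) (R s : ℝ) (hs : s ∈ Icc (-R) R) :
    cumulantIntegrand d 1 2 R s = (sphereArea (d - 1) / (d - 1 : ℕ)) ^ 2 * 2 ^ (d - 1) *
      (Real.cosh R - Real.cosh s) ^ (d - 1) := by
  have hcs : Real.cosh s ≤ Real.cosh R := by
    have hs' : |s| ≤ R := abs_le.2 hs
    rw [Real.cosh_le_cosh, abs_of_nonneg ((abs_nonneg s).trans hs')]; exact hs'
  have h1 : 0 ≤ 2 * (Real.cosh R - Real.cosh s) * Real.exp s :=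
    mul_nonneg (by linarith) (Real.exp_pos s).le
  rw [cumulantIntegrand_horosphere hd 2 R s hs, mul_comm (d - 1) 2, pow_mul, Real.sq_sqrt h1,
    ← mul_pow, mul_assoc _ (Real.exp s), ← Real.exp_add, add_neg_cancel, Real.exp_zero, mul_one,
    mul_pow, mul_assoc]

/-- The limiting integrand of `I_{1,k}(R)`, in terms of the distance from the boundary sphere. -/
def horosphereProfile (n k : ℕ) (t : ℝ) : ℝ :=
  Real.exp (-(n * (k - 2) / 2) * t) * √(1 - Real.exp (-t)) ^ (n * k)

lemma integrableOn_horosphereBound {n k : ℕ} (hn : 1 ≤ n) (hk : 2 < k) :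
    IntegrableOn (fun t : ℝ => Real.exp (-((n : ℝ) * (k - 2) / 2) * t)) (Ioi 0) := by
  have h1 : (0 : ℝ) < n := by exact_mod_cast hn
  have h2 : (0 : ℝ) < k - 2 := by
    have : (2 : ℝ) < k := by exact_mod_cast hk
    linarith
  exact exp_neg_integrableOn_Ioi 0 (by positivity)

lemma continuous_horosphereProfile (n k : ℕ) : Continuous (horosphereProfile n k) := by
  unfold horosphereProfile; fun_prop

lemma horosphereProfile_le {n k : ℕ} {t : ℝ} :
    horosphereProfile n k t ≤ Real.exp (-(n * (k - 2) / 2) * t) := by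
  refine mul_le_of_le_one_right (Real.exp_pos _).le (pow_le_one₀ (Real.sqrt_nonneg _) ?_)
  exact Real.sqrt_le_one.2 (by linarith [Real.exp_pos (-t)])

lemma integral_horosphereProfile_pos {n k : ℕ} (hn : 1 ≤ n) (hk : 2 < k) :
    0 < ∫ t in Ioi 0, horosphereProfile n k t := by
  have hnn : ∀ t, 0 ≤ horosphereProfile n k t := fun t => by
    unfold horosphereProfile; positivity
  have hint : IntegrableOn (horosphereProfile n k) (Ioi 0) := by
    refine (integrableOn_horosphereBound hn hk).mono'
      (continuous_horosphereProfile n k).aestronglyMeasurable (Eventually.of_forall fun t => ?_)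
    rw [Real.norm_of_nonneg (hnn t)]
    exact horosphereProfile_le
  rw [setIntegral_pos_iff_support_of_nonneg_ae (Eventually.of_forall hnn) hint]
  have : Function.support (horosphereProfile n k) ∩ Ioi 0 = Ioi 0 := by
    rw [inter_eq_right]
    intro t ht
    have : Real.exp (-t) < 1 := Real.exp_lt_one_iff.2 (by simpa using ht)
    have : 0 < √(1 - Real.exp (-t)) := Real.sqrt_pos.2 (by linarith)
    have h2 : 0 < horosphereProfile n k t := by unfold horosphereProfile; positivity
    exact h2.ne'
  rw [this]
  simp

/-- Substitute `s = R - t`. With `n = d - 1`, the integrand splits off `e^{(k-1)nR}`, and what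
remains decays like `e^{-n(k-2)t/2}`, which is where `k > 2` enters. -/
theorem isEquivalent_cumulantIntegral_horosphere {d k : ℕ} (hd : 2 ≤ d) (hk : 2 < k) :
    (fun R : ℝ => (cumulantIntegral d 1 k R).toReal) ~[atTop]
      fun R : ℝ => (sphereArea (d - 1) / (d - 1 : ℕ)) ^ k *
        (∫ t in Ioi 0, horosphereProfile (d - 1) k t) *
          Real.exp (((k : ℝ) - 1) * ((d : ℝ) - 1) * R) := by
  obtain ⟨n, rfl⟩ : ∃ n, d = n + 1 := ⟨d - 1, by omega⟩
  have hn : 1 ≤ n := by omega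
  have hnR : (0 : ℝ) < n := by exact_mod_cast hn
  have hω := sphereArea_pos hn
  have hI := integral_horosphereProfile_pos hn hk
  rw [Nat.add_sub_cancel]
  have hc : ((n + 1 : ℕ) : ℝ) - 1 = n := by push_cast; ring
  rw [hc]
  refine isEquivalent_const_mul_of_tendsto (by positivity)
    (Eventually.of_forall fun R => (Real.exp_pos _).ne') ?_
  -- `D R t` is the squared radius of the section divided by `e^{2R - t}`; it tends to `1 - e^{-t}`.
  let D : ℝ → ℝ → ℝ := fun R t => 1 + Real.exp (-2 * R) - Real.exp (-t) - Real.exp (t - 2 * R)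
  let F : ℝ → ℝ → ℝ := fun R t => (Icc 0 (2 * R)).indicator
    (fun t => Real.exp (-(n * (k - 2) / 2) * t) * √(D R t) ^ (n * k)) t
  have hexp : ∀ R t, 2 * (Real.cosh R - Real.cosh (R - t)) * Real.exp (R - t) =
      Real.exp (R - t / 2) ^ 2 * D R t := by
    intro R t
    have e1 : Real.exp (R - t / 2) ^ 2 = Real.exp R * Real.exp R * Real.exp (-t) := by
      rw [sq, ← Real.exp_add, ← Real.exp_add, ← Real.exp_add]; congr 1; ring
    have e2 : Real.exp (-2 * R) = Real.exp (-R) * Real.exp (-R) := by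
      rw [← Real.exp_add]; congr 1; ring
    have e3 : Real.exp (t - 2 * R) = Real.exp t * (Real.exp (-R) * Real.exp (-R)) := by
      rw [← Real.exp_add, ← Real.exp_add]; congr 1; ring
    have e4 : Real.exp (R - t) = Real.exp R * Real.exp (-t) := by
      rw [← Real.exp_add]; congr 1
    have e5 : Real.exp (-(R - t)) = Real.exp (-R) * Real.exp t := by
      rw [← Real.exp_add]; congr 1; ring
    have e6 : Real.exp R * Real.exp (-R) = 1 := by rw [← Real.exp_add]; simp
    simp only [D]
    rw [Real.cosh_eq, Real.cosh_eq, e1, e2, e3, e4, e5]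
    generalize Real.exp R = a at *
    generalize Real.exp (-R) = a' at *
    generalize Real.exp t = b at *
    generalize Real.exp (-t) = b' at *
    linear_combination (b * b' * a * a' - b' * a * a') * e6
  have hFint : ∀ R, (cumulantIntegral (n + 1) 1 k R).toReal / Real.exp (((k : ℝ) - 1) * n * R) =
      (sphereArea n / n) ^ k * ∫ t, F R t := by
    intro R
    rw [toReal_cumulantIntegral hd 1 (by omega), ← integral_indicator measurableSet_Icc,
      ← integral_sub_left_eq_self _ _ R, ← integral_const_mul, ← integral_div]
    refine integral_congr_ae (Eventually.of_forall fun t => ?_)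
    have hiff : R - t ∈ Icc (-R) R ↔ t ∈ Icc 0 (2 * R) := by
      simp only [mem_Icc]; constructor <;> rintro ⟨h1, h2⟩ <;> constructor <;> linarith
    simp only [F, indicator, hiff]
    split_ifs with ht
    · have := cumulantIntegrand_horosphere hd k R (R - t) (hiff.2 ht)
      simp only [Set.Icc.coe_one]
      rw [this, Nat.add_sub_cancel, hexp, Real.sqrt_mul (by positivity),
        Real.sqrt_sq (Real.exp_pos _).le, mul_pow, mul_div_assoc]
      congr 1
      have e : Real.exp (R - t / 2) ^ (n * k) * Real.exp (-(R - t)) ^ n =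
          Real.exp (((k : ℝ) - 1) * n * R) * Real.exp (-(n * (k - 2) / 2) * t) := by
        rw [← Real.exp_nat_mul, ← Real.exp_nat_mul, ← Real.exp_add, ← Real.exp_add]
        congr 1
        push_cast
        ring
      rw [mul_right_comm, e]
      have := Real.exp_pos (((k : ℝ) - 1) * n * R)
      field_simp
    · simp
  simp only [hFint]
  refine Tendsto.const_mul _ ?_
  rw [← integral_Ici_eq_integral_Ioi, ← integral_indicator measurableSet_Ici]
  refine tendsto_integral_filter_of_dominated_convergence
    ((Ici 0).indicator fun t => Real.exp (-(n * (k - 2) / 2) * t)) ?_ ?_ ?_ ?_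
  · refine Eventually.of_forall fun R => Measurable.aestronglyMeasurable ?_
    refine Measurable.indicator ?_ measurableSet_Icc
    simp only [D]
    fun_prop
  · refine Eventually.of_forall fun R => Eventually.of_forall fun t => ?_
    simp only [F, indicator]
    split_ifs with h1 h2 h2
    · rw [Real.norm_of_nonneg (by positivity)]
      refine mul_le_of_le_one_right (Real.exp_pos _).le (pow_le_one₀ (Real.sqrt_nonneg _) ?_)
      rw [Real.sqrt_le_one]
      -- `t ≤ 2R` is exactly what gives `D R t ≤ 1`.
      have e1 : Real.exp (-2 * R) ≤ Real.exp (-t) := Real.exp_le_exp.2 (by linarith [h1.2])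
      have e2 := Real.exp_pos (t - 2 * R)
      simp only [D]
      linarith
    · exact absurd h1.1 h2
    · rw [norm_zero]; exact (Real.exp_pos _).le
    · simp
  · rw [integrable_indicator_iff measurableSet_Ici, integrableOn_Ici_iff_integrableOn_Ioi]
    exact integrableOn_horosphereBound hn hk
  · refine Eventually.of_forall fun t => ?_
    by_cases ht : 0 ≤ t
    · have hD : Tendsto (fun R => D R t) atTop (𝓝 (1 - Real.exp (-t))) := by
        have l1 : Tendsto (fun R : ℝ => Real.exp (-2 * R)) atTop (𝓝 0) :=
          Real.tendsto_exp_atBot.comp (tendsto_id.const_mul_atTop_of_neg (by norm_num))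
        have l2 : Tendsto (fun R : ℝ => Real.exp t * Real.exp (-2 * R)) atTop (𝓝 0) := by
          simpa using l1.const_mul (Real.exp t)
        have := ((l1.const_add 1).sub_const (Real.exp (-t))).sub l2
        simp only [add_zero, sub_zero] at this
        refine this.congr fun R => ?_
        simp only [D]
        rw [← Real.exp_add]
        congr 2; ring
      have h1 : (Ici 0).indicator (horosphereProfile n k) t = horosphereProfile n k t :=
        indicator_of_mem ht _
      rw [h1]
      refine (((Real.continuous_sqrt.tendsto _).comp hD).pow (n * k)).const_mul
        (Real.exp (-(n * (k - 2) / 2) * t)) |>.congr' ?_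
      filter_upwards [eventually_ge_atTop t] with R hR
      have hmem : t ∈ Icc 0 (2 * R) := ⟨ht, by linarith⟩
      simp only [F]
      rw [indicator_of_mem hmem]
      rfl
    · have h1 : (Ici 0).indicator (horosphereProfile n k) t = 0 := indicator_of_notMem ht _
      rw [h1]
      refine tendsto_const_nhds.congr fun R => ?_
      have hmem : t ∉ Icc 0 (2 * R) := fun h => ht h.1
      simp only [F]
      rw [indicator_of_notMem hmem]

end

section

/-! ### Bounds in the hyperbolic plane -/

variable {lam : ℝ}

lemma inv_sqrt_pow_eq_rpow {x : ℝ} (hx : 0 ≤ x) (k : ℕ) : (√x)⁻¹ ^ k = x ^ (-((k : ℝ) / 2)) := by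
  rw [Real.sqrt_eq_rpow, ← Real.rpow_neg hx, ← Real.rpow_mul_natCast hx]
  congr 1
  ring

/-- The length is at most `2 log(2 + mQ) / √m` with `m ≥ 1 - lam`, and the `k`-th power of the
logarithm costs `(2k)^k √(2 + mQ)`. Multiplied by the density, the root is still at most `2 e^{R/2}
e^{|s|/2}`, whose integral over `|s| ≤ R` has order `e^R`. -/
lemma cumulantIntegrand_two_le {k : ℕ} (hk : 1 ≤ k) (h0 : 0 ≤ lam) (h1 : lam < 1) {R s : ℝ}
    (hs : |s| ≤ R) :
    cumulantIntegrand 2 lam k R s ≤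
      (sphereArea 1 * (4 * k)) ^ k * (1 - lam) ^ (-((k : ℝ) / 2)) *
        (2 * Real.exp (R / 2) * (2 * Real.cosh (s / 2))) := by
  have hm : 0 < 1 - lam ^ 2 := by nlinarith
  have hl : 0 < 1 - lam := by linarith
  set m := 1 - lam ^ 2 with hmdef
  have hκ : 0 < √m := Real.sqrt_pos.2 hm
  have hQ := capHeight_nonneg h0 h1.le hs
  have hc := scale_pos h0 h1.le s
  have hω := sphereArea_pos (n := 1) le_rfl
  have hR : 0 ≤ R := (abs_nonneg s).trans hs
  have hv := capVol_nonneg 1 m (capHeight lam R s)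
  have hce := scale_le_exp_abs h0 h1.le s
  have hQc : m * capHeight lam R s * scale lam s ≤ Real.exp R := by
    have e : capHeight lam R s * scale lam s = Real.cosh R - Real.cosh s := by
      rw [capHeight]; field_simp
    have hm1 : m ≤ 1 := by rw [hmdef]; nlinarith
    have h3 : 0 ≤ capHeight lam R s * scale lam s := by positivity
    calc _ = m * (capHeight lam R s * scale lam s) := by ring
      _ ≤ 1 * (capHeight lam R s * scale lam s) := by gcongr
      _ ≤ Real.exp R := by rw [one_mul, e]; linarith [cosh_le_exp hR, Real.cosh_pos s]
  have hsq : √(2 + m * capHeight lam R s) * scale lam s ≤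
      2 * Real.exp (R / 2) * (2 * Real.cosh (s / 2)) := by
    have hceR : scale lam s ≤ Real.exp R := hce.trans (Real.exp_le_exp.2 hs)
    -- The constant `3` would do; `4` has an integral square root.
    have e1 : (2 + m * capHeight lam R s) * scale lam s ≤ 4 * Real.exp R := by
      nlinarith [Real.exp_pos R]
    have e2 : √(2 + m * capHeight lam R s) * scale lam s ≤
        2 * Real.exp (R / 2) * Real.exp (|s| / 2) := by
      refine le_of_sq_le_sq ?_ (by positivity)
      rw [mul_pow, Real.sq_sqrt (by positivity), mul_pow, mul_pow, ← Real.exp_nat_mul,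
        ← Real.exp_nat_mul]
      have a1 : ((2 : ℕ) : ℝ) * (R / 2) = R := by push_cast; ring
      have a2 : ((2 : ℕ) : ℝ) * (|s| / 2) = |s| := by push_cast; ring
      rw [a1, a2]
      calc _ = ((2 + m * capHeight lam R s) * scale lam s) * scale lam s := by ring
        _ ≤ (4 * Real.exp R) * Real.exp |s| := by gcongr
        _ = _ := by ring
    refine e2.trans ?_
    gcongr
    -- `e^{|s|/2}` is replaced by the larger `2 cosh(s/2)`, which is smooth with an elementary
    -- primitive.
    have e3 : Real.cosh (s / 2) = Real.cosh (|s| / 2) := by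
      rw [← Real.cosh_abs (s / 2), abs_div, abs_two]
    rw [e3, Real.cosh_eq]
    linarith [Real.exp_pos (-(|s| / 2))]
  have hvol : capVol 1 m (capHeight lam R s) ^ k ≤
      (4 * k) ^ k * (1 - lam) ^ (-((k : ℝ) / 2)) * √(2 + m * capHeight lam R s) := by
    have e1 := capVol_one_le_log hm hQ
    have hx : 1 ≤ 2 + m * capHeight lam R s := by
      have := mul_nonneg hm.le hQ
      linarith
    have e2 := log_pow_le hk hx
    have e3 : (√m)⁻¹ ^ k ≤ (1 - lam) ^ (-((k : ℝ) / 2)) := by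
      rw [← inv_sqrt_pow_eq_rpow hl.le]
      have : 1 - lam ≤ m := by rw [hmdef]; nlinarith
      have := Real.sqrt_le_sqrt this
      have := Real.sqrt_pos.2 hl
      gcongr
    calc capVol 1 m (capHeight lam R s) ^ k
        = (√m)⁻¹ ^ k * (√m * capVol 1 m (capHeight lam R s)) ^ k := by
          rw [← mul_pow, inv_mul_cancel_left₀ hκ.ne']
      _ ≤ (1 - lam) ^ (-((k : ℝ) / 2)) * (2 * Real.log (2 + m * capHeight lam R s)) ^ k := by
          gcongr
      _ ≤ (1 - lam) ^ (-((k : ℝ) / 2)) * (2 ^ k * ((2 * k) ^ k * √(2 + m * capHeight lam R s))) := by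
          rw [mul_pow]; gcongr
      _ = _ := by
          rw [← mul_assoc (2 ^ k), ← mul_pow]; ring
  calc cumulantIntegrand 2 lam k R s
      = sphereArea 1 ^ k * capVol 1 m (capHeight lam R s) ^ k * scale lam s := by
        rw [cumulantIntegrand, show 2 - 1 = 1 from rfl, mul_pow, pow_one]
    _ ≤ sphereArea 1 ^ k * ((4 * k) ^ k * (1 - lam) ^ (-((k : ℝ) / 2)) *
          √(2 + m * capHeight lam R s)) * scale lam s := by gcongr
    _ = (sphereArea 1 * (4 * k)) ^ k * (1 - lam) ^ (-((k : ℝ) / 2)) *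
          (√(2 + m * capHeight lam R s) * scale lam s) := by rw [mul_pow]; ring
    _ ≤ _ := by gcongr

lemma cumulantIntegral_two_le {k : ℕ} (hk : 1 ≤ k) (lam : unitInterval) (h1 : (lam : ℝ) < 1)
    {R : ℝ} (hR : 0 ≤ R) :
    cumulantIntegral 2 lam k R ≤ ENNReal.ofReal ((8 * (sphereArea 1 * (4 * k)) ^ k) *
      (1 - (lam : ℝ)) ^ (-((k : ℝ) / 2)) * Real.exp R) := by
  have hω := sphereArea_pos (n := 1) le_rfl
  have hl : 0 < 1 - (lam : ℝ) := by linarith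
  set C : ℝ := (sphereArea 1 * (4 * k)) ^ k * (1 - (lam : ℝ)) ^ (-((k : ℝ) / 2)) with hC
  have hC0 : 0 ≤ C := by positivity
  let b : ℝ → ℝ := fun s => C * (2 * Real.exp (R / 2) * (2 * Real.cosh (s / 2)))
  have hb : Continuous b := by fun_prop
  have hbn : ∀ s, 0 ≤ b s := fun s => by
    have := Real.cosh_pos (s / 2); positivity
  have hint : ∫ s in Icc (-R) R, b s = C * (2 * Real.exp (R / 2) * (8 * Real.sinh (R / 2))) := by
    simp only [b]
    rw [integral_const_mul, integral_const_mul, integral_Icc_eq_integral_Ioc,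
      ← intervalIntegral.integral_of_le (by linarith)]
    have hd : ∀ s ∈ uIcc (-R) R, HasDerivAt (fun s => 4 * Real.sinh (s / 2))
        (2 * Real.cosh (s / 2)) s := fun s _ => by
      refine (((hasDerivAt_id s).div_const 2).sinh.const_mul 4).congr_deriv ?_
      simp only [id]; ring
    rw [intervalIntegral.integral_eq_sub_of_hasDerivAt hd
      ((by fun_prop : Continuous fun s : ℝ => 2 * Real.cosh (s / 2)).intervalIntegrable _ _),
      neg_div, Real.sinh_neg]
    ring
  rw [cumulantIntegral_eq le_rfl lam (by omega)]
  calc _ ≤ ∫⁻ s in Icc (-R) R, ENNReal.ofReal (b s) := by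
        refine setLIntegral_mono' measurableSet_Icc fun s hs => ENNReal.ofReal_le_ofReal ?_
        exact cumulantIntegrand_two_le hk lam.2.1 h1 (abs_le.2 hs)
    _ = ENNReal.ofReal (∫ s in Icc (-R) R, b s) :=
        (ofReal_integral_eq_lintegral_ofReal hb.integrableOn_Icc
          (Eventually.of_forall hbn)).symm
    _ ≤ _ := by
        rw [hint]
        refine ENNReal.ofReal_le_ofReal ?_
        -- The constant `8` of the bound is `2 * 8 / 2`.
        have e1 : Real.sinh (R / 2) ≤ Real.exp (R / 2) / 2 := by
          rw [Real.sinh_eq]; linarith [Real.exp_pos (-(R / 2))]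
        have e2 : Real.exp (R / 2) * Real.exp (R / 2) = Real.exp R := by
          rw [← Real.exp_add, add_halves]
        calc C * (2 * Real.exp (R / 2) * (8 * Real.sinh (R / 2)))
            ≤ C * (2 * Real.exp (R / 2) * (8 * (Real.exp (R / 2) / 2))) := by gcongr
          _ = 8 * C * (Real.exp (R / 2) * Real.exp (R / 2)) := by ring
          _ = _ := by rw [e2, hC]; ring

/-- The scale is half of `(1 - lam) e^s + (1 + lam) e^{-s}`. The threshold makes the first term at
least `2`, while the second is at most `2`. -/
lemma scale_bounds_of_large (h0 : 0 ≤ lam) (h1 : lam < 1) {s : ℝ} (hs : 2 / (1 - lam) ≤ s) :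
    (1 - lam) * Real.exp s / 2 ≤ scale lam s ∧ scale lam s ≤ (1 - lam) * Real.exp s := by
  have hl : 0 < 1 - lam := by linarith
  have hs0 : 0 ≤ s := le_trans (by positivity) hs
  have e : scale lam s = ((1 - lam) * Real.exp s + (1 + lam) * Real.exp (-s)) / 2 := by
    rw [scale, Real.cosh_eq, Real.sinh_eq]; ring
  have h2 : 2 ≤ (1 - lam) * Real.exp s := by
    rw [div_le_iff₀ hl] at hs
    have := Real.add_one_le_exp s
    nlinarith
  have h3 : Real.exp (-s) ≤ 1 := Real.exp_le_one_iff.2 (by linarith)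
  have h4 := Real.exp_pos (-s)
  rw [e]
  constructor
  · have : 0 ≤ (1 + lam) * Real.exp (-s) := by positivity
    linarith
  · nlinarith

/-- In this strip `e^s` and `e^R` are comparable, so `mQ` is bounded below and the arc, no shorter
than its chart radius, has length at least a multiple of `(1 - lam)^(-1/2)`. The density supplies a
further `(1 - lam) e^R`, hence the exponent `-(k/2 - 1)`. The bound on `R` puts the strip beyond the
threshold `2 / (1 - lam)`. -/
lemma le_cumulantIntegrand_two {k : ℕ} (h0 : 0 ≤ lam) (h1 : lam < 1) {R s : ℝ}
    (hR : 2 + 2 / (1 - lam) < R) (hs : s ∈ Icc (R - 2) (R - 1)) :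
    ((sphereArea 1 / 4) ^ k * (Real.exp (-2) / 2)) * (1 - lam) ^ (-((k : ℝ) / 2 - 1)) * Real.exp R ≤
      cumulantIntegrand 2 lam k R s := by
  have hm : 0 < 1 - lam ^ 2 := by nlinarith
  have hl : 0 < 1 - lam := by linarith
  set m := 1 - lam ^ 2 with hmdef
  have hκ : 0 < √m := Real.sqrt_pos.2 hm
  have hω := sphereArea_pos (n := 1) le_rfl
  have h2l : 2 ≤ 2 / (1 - lam) := by
    rw [le_div_iff₀ hl]; linarith
  have hs0 : 2 ≤ s := by linarith [hs.1]
  have hsR : |s| ≤ R := by rw [abs_of_nonneg (by linarith)]; linarith [hs.2]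
  have hQ := capHeight_nonneg h0 h1.le hsR
  have hc := scale_pos h0 h1.le s
  obtain ⟨hc1, hc2⟩ := scale_bounds_of_large h0 h1 (s := s) (by linarith [hs.1])
  have hmQ : 1 / 4 ≤ m * capHeight lam R s := by
    -- Since `s ≤ R - 1`, `e^R ≥ 2 e^s`, so `cosh R - cosh s ≥ e^s / 4`; the scale is at most `(1 -
    -- lam) e^s` and `m ≥ 1 - lam`.
    have es := Real.exp_pos s
    have e1 : 2 * Real.exp s ≤ Real.exp R := by
      have a : Real.exp R = Real.exp s * Real.exp (R - s) := by rw [← Real.exp_add]; congr 1; ring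
      have b := Real.add_one_le_exp (R - s)
      rw [a]
      nlinarith [hs.2]
    have e2 : 2 ≤ Real.exp s := by linarith [Real.add_one_le_exp s]
    have e3 : Real.exp (-s) ≤ 1 := Real.exp_le_one_iff.2 (by linarith)
    have e4 : Real.exp s / 4 ≤ Real.cosh R - Real.cosh s := by
      rw [Real.cosh_eq, Real.cosh_eq]
      linarith [Real.exp_pos (-R)]
    have hml : 1 - lam ≤ m := by rw [hmdef]; nlinarith
    rw [capHeight, ← mul_div_assoc, le_div_iff₀ hc]
    calc 1 / 4 * scale lam s ≤ 1 / 4 * ((1 - lam) * Real.exp s) := by gcongr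
      _ = (1 - lam) * (Real.exp s / 4) := by ring
      _ ≤ m * (Real.cosh R - Real.cosh s) := by gcongr
  have hP : (√(1 - lam))⁻¹ / 4 ≤ capVol 1 m (capHeight lam R s) := by
    refine le_trans ?_ (chartRadius_le_capVol_one hm.le hQ)
    refine le_of_sq_le_sq ?_ (chartRadius_nonneg _ _)
    rw [chartRadius_sq hm.le hQ, div_pow, inv_pow, Real.sq_sqrt hl.le]
    have hx : 0 < 1 + m * capHeight lam R s / 2 := by positivity
    have hml : m ≤ 2 * (1 - lam) := by rw [hmdef]; nlinarith
    rw [inv_eq_one_div, div_div, div_le_div_iff₀ (by positivity) hx]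
    nlinarith
  have hexp : Real.exp (-2) * Real.exp R ≤ Real.exp s := by
    rw [← Real.exp_add]; exact Real.exp_le_exp.2 (by linarith [hs.1])
  have hrpow : (1 - lam) ^ (-((k : ℝ) / 2 - 1)) = (√(1 - lam))⁻¹ ^ k * (1 - lam) := by
    rw [inv_sqrt_pow_eq_rpow hl.le, neg_sub, sub_eq_add_neg 1 ((k : ℝ) / 2), Real.rpow_add hl,
      Real.rpow_one, mul_comm]
  rw [cumulantIntegrand, show 2 - 1 = 1 from rfl, pow_one, hrpow]
  have hsl := Real.sqrt_pos.2 hl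
  calc _ = (sphereArea 1 * ((√(1 - lam))⁻¹ / 4)) ^ k *
        ((1 - lam) * (Real.exp (-2) * Real.exp R) / 2) := by
        rw [mul_pow, div_pow, div_pow]; ring
    _ ≤ (sphereArea 1 * capVol 1 m (capHeight lam R s)) ^ k * ((1 - lam) * Real.exp s / 2) := by
        have := capVol_nonneg 1 m (capHeight lam R s)
        gcongr
    _ ≤ _ := by
        have := capVol_nonneg 1 m (capHeight lam R s)
        gcongr

lemma le_cumulantIntegral_two {k : ℕ} (hk : 1 ≤ k) (lam : unitInterval) (h1 : (lam : ℝ) < 1)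
    {R : ℝ} (hR : 2 + 2 / (1 - (lam : ℝ)) < R) :
    ENNReal.ofReal (((sphereArea 1 / 4) ^ k * (Real.exp (-2) / 2)) *
      (1 - (lam : ℝ)) ^ (-((k : ℝ) / 2 - 1)) * Real.exp R) ≤ cumulantIntegral 2 lam k R := by
  have hl : 0 < 1 - (lam : ℝ) := by linarith
  have h2l : 0 < 2 / (1 - (lam : ℝ)) := by positivity
  rw [cumulantIntegral_eq le_rfl lam (by omega)]
  calc _ = ∫⁻ _ in Icc (R - 2) (R - 1), ENNReal.ofReal (((sphereArea 1 / 4) ^ k *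
        (Real.exp (-2) / 2)) * (1 - (lam : ℝ)) ^ (-((k : ℝ) / 2 - 1)) * Real.exp R) := by
        have : R - 1 - (R - 2) = 1 := by ring
        rw [lintegral_const, Measure.restrict_apply_univ, Real.volume_Icc, this]
        simp
    _ ≤ ∫⁻ s in Icc (R - 2) (R - 1), ENNReal.ofReal (cumulantIntegrand 2 lam k R s) :=
        setLIntegral_mono' measurableSet_Icc fun s hs => ENNReal.ofReal_le_ofReal
          (le_cumulantIntegrand_two lam.2.1 h1 hR hs)
    _ ≤ _ := lintegral_mono_set (Icc_subset_Icc (by linarith) (by linarith))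

end

end LambdaHyp

end

/-! ### Assembly of the four regimes -/

open LambdaHyp

theorem proposition5p1 :
    -- (i) `d = 2`, `lam < 1`
    (∃ (A B : ℕ → ℝ) (R₀ : ℕ → unitInterval → ℝ), ∀ k : ℕ, 2 ≤ k → 0 < A k ∧ 0 < B k ∧
      ∀ lam : unitInterval, (lam : ℝ) < 1 → ∀ R : ℝ, R₀ k lam < R →
        ENNReal.ofReal (A k * (1 - (lam : ℝ)) ^ (-((k : ℝ) / 2 - 1)) * Real.exp R) ≤
            LambdaHyp.cumulantIntegral 2 lam k R ∧
        LambdaHyp.cumulantIntegral 2 lam k R ≤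
            ENNReal.ofReal (B k * (1 - (lam : ℝ)) ^ (-((k : ℝ) / 2)) * Real.exp R)) ∧
    -- (ii) `d = 3`, `lam < 1`
    (∃ A : ℕ → ℝ, (∀ k : ℕ, 2 ≤ k → 0 < A k) ∧
      ∀ lam : unitInterval, (lam : ℝ) < 1 →
        (∀ k : ℕ, 2 < k →
          (fun R : ℝ => (LambdaHyp.cumulantIntegral 3 lam k R).toReal) ~[atTop]
            fun R : ℝ => A k * (1 - (lam : ℝ) ^ 2) ^ (1 - (k : ℝ) / 2) * Real.exp (k * R)) ∧
        (fun R : ℝ => (LambdaHyp.cumulantIntegral 3 lam 2 R).toReal) ~[atTop]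
          fun R : ℝ => A 2 * R * Real.exp (2 * R)) ∧
    -- (iii) `d ≥ 4`, `lam < 1`
    (∃ A : ℕ → ℕ → ℝ, ∀ d : ℕ, 4 ≤ d → ∀ k : ℕ, 2 ≤ k → 0 < A k d ∧
      ∀ lam : unitInterval, (lam : ℝ) < 1 →
        (fun R : ℝ => (LambdaHyp.cumulantIntegral d lam k R).toReal) ~[atTop]
          fun R : ℝ => A k d * (1 - (lam : ℝ) ^ 2) ^ (((d : ℝ) - 1 - k) / 2) *
            Real.exp (k * ((d : ℝ) - 2) * R)) ∧
    -- (iv) `lam = 1`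
    (∃ A : ℕ → ℕ → ℝ, ∀ d : ℕ, 2 ≤ d →
      (∀ k : ℕ, 2 ≤ k → 0 < A k d) ∧
      (∀ k : ℕ, 2 < k →
        (fun R : ℝ => (LambdaHyp.cumulantIntegral d 1 k R).toReal) ~[atTop]
          fun R : ℝ => A k d * Real.exp (((k : ℝ) - 1) * ((d : ℝ) - 1) * R)) ∧
      (fun R : ℝ => (LambdaHyp.cumulantIntegral d 1 2 R).toReal) ~[atTop]
        fun R : ℝ => A 2 d * R * Real.exp (((d : ℝ) - 1) * R)) := by
  refine ⟨?_, ?_, ?_, ?_⟩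
  · refine ⟨fun k => (sphereArea 1 / 4) ^ k * (Real.exp (-2) / 2),
      fun k => 8 * (sphereArea 1 * (4 * k)) ^ k, fun _ lam => 2 + 2 / (1 - (lam : ℝ)),
      fun k hk => ⟨?_, ?_, fun lam hlam R hR => ⟨?_, ?_⟩⟩⟩
    · have := sphereArea_pos (n := 1) le_rfl
      positivity
    · have := sphereArea_pos (n := 1) le_rfl
      have : (0 : ℝ) < k := by positivity
      positivity
    · exact le_cumulantIntegral_two (by omega) lam hlam hR
    · have : 0 < 2 / (1 - (lam : ℝ)) := div_pos two_pos (by linarith)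
      exact cumulantIntegral_two_le (by omega) lam hlam (by linarith)
  · have hω := sphereArea_pos (n := 2) (by norm_num)
    -- For `d = 3`, `k = 2` the exponent `k(d-2) - (d-1)` is zero and the integral in
    -- `cumulantConst` diverges, so the constant comes from the logarithmic regime.
    refine ⟨fun k => if k = 2 then sphereArea 2 ^ 2 * (2 * (1 / 2) ^ 2) else cumulantConst k 3,
      fun k hk => ?_, fun lam hlam => ⟨fun k hk => ?_, ?_⟩⟩
    · dsimp only
      split_ifs with h
      · positivity
      · exact cumulantConst_pos le_rfl (by omega)
    · have h := isEquivalent_cumulantIntegral (d := 3) (k := k) le_rfl (by omega) lam hlam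
      have e1 : (((3 : ℕ) : ℝ) - 1 - k) / 2 = 1 - (k : ℝ) / 2 := by push_cast; ring
      have e2 : (k : ℝ) * (((3 : ℕ) : ℝ) - 2) = k := by push_cast; ring
      simp only [e1, e2] at h
      simpa only [if_neg (show k ≠ 2 by omega)] using h
    · have h := isEquivalent_of_integrand_eq (d := 3) (k := 2) (n := 2) (by norm_num) two_ne_zero
        lam (pow_pos hω 2) fun R s hs => cumulantIntegrand_three_two hlam R s hs
      simpa only [if_true, mul_assoc, Nat.cast_ofNat] using h
  · exact ⟨cumulantConst, fun d hd k hk => by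
      -- Already `2(d - 2) > d - 1` as soon as `d ≥ 4`, so no critical case occurs.
      have hlt : d - 1 < k * (d - 2) := by
        have := Nat.mul_le_mul_right (d - 2) hk
        omega
      exact ⟨cumulantConst_pos (by omega) hlt, fun lam hlam =>
        isEquivalent_cumulantIntegral (by omega) hlt lam hlam⟩⟩
  · refine ⟨fun k d => if k = 2 then (sphereArea (d - 1) / (d - 1 : ℕ)) ^ 2 * 2 ^ (d - 1) *
        (2 * (1 / 2) ^ (d - 1)) else (sphereArea (d - 1) / (d - 1 : ℕ)) ^ k *
        ∫ t in Set.Ioi 0, horosphereProfile (d - 1) k t, fun d hd => ?_⟩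
    have hω := sphereArea_pos (n := d - 1) (by omega)
    have hd1 : (0 : ℝ) < (d - 1 : ℕ) := by
      have : 0 < d - 1 := by omega
      exact_mod_cast this
    refine ⟨fun k hk => ?_, fun k hk => ?_, ?_⟩
    · dsimp only
      split_ifs with h
      · positivity
      · have := integral_horosphereProfile_pos (n := d - 1) (k := k) (by omega) (by omega)
        positivity
    · simpa only [if_neg (show k ≠ 2 by omega)] using
        isEquivalent_cumulantIntegral_horosphere hd hk
    · have h := isEquivalent_of_integrand_eq hd two_ne_zero 1 (n := d - 1)
        (C := (sphereArea (d - 1) / (d - 1 : ℕ)) ^ 2 * 2 ^ (d - 1)) (by positivity)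
        fun R s hs => cumulantIntegrand_horosphere_two hd R s hs
      rw [Nat.cast_sub (by omega : 1 ≤ d), Nat.cast_one] at h
      simp only [if_true]
      refine h.congr_right (Eventually.of_forall fun R => ?_)
      rw [Nat.cast_sub (by omega : 1 ≤ d), Nat.cast_one]
      ring
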